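/- Identify $\mathbb R^n$ with its dual by the standard pairing $\langle\cdot,\cdot\rangle$. For a convex body $K\subset\mathbb R^n$ with the origin in its interior let $K^\circ=\{p:\langle p,q\rangle\le 1\ \forall q\in K\}$, and for such a body $T$ put $\|x\|_T=\max_{p\in T}\langle p,x\rangle$ (so $\|\cdot\|_{K^\circ}$ is the norm, possibly non-symmetric, with unit body $K$). The smooth piece of $\partial K$ is the set of $q\in\partial K$ at which $\|\cdot\|_{K^\circ}$ is differentiable (for a polytope: the union of the relative interiors of the facets), and there $n_K(q)=d\|q\|_{K^\circ}$. Hanner polytopes are the bodies obtained from the segment $[-1,1]\subset\mathbb R$ by iterating the operations $(K,L)\mapsto K\oplus_1L$ and $(K,L)\mapsto K\oplus_\infty L$, where for $K\subset\mathbb R^k$ and $L\subset\mathbb R^l$, the unit bodies of norms $\|\cdot\|^{(1)}$ and $\|\cdot\|^{(2)}$, the bodies $K\oplus_1L,\ K\oplus_\infty L\subset\mathbb R^{k+l}$ are the unit bodies of $\|\cdot\|^{(1)}+\|\cdot\|^{(2)}$ and $\max\{\|\cdot\|^{(1)},\|\cdot\|^{(2)}\}$, respectively. A closed classical billiard trajectory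 in $K\times T$ consists of $m\ge 2$ bounce points $q_1,\dots,q_m$ in the smooth piece of $\partial K$ and momenta $p_1,\dots,p_m$ in the smooth piece of $\partial T$, indices modulo $m$, such that for all $i$ $$p_{i+1}-p_i=-\lambda_i\,n_K(q_i),\qquad q_{i+1}-q_i=\mu_i\,n_T(p_{i+1}),\qquad \lambda_i,\mu_i>0 .$$ Its length is $\ell_T(q_1,\dots,q_m)=\sum_{i=1}^m\|q_{i+1}-q_i\|_T$, and it traces in phase space the closed curve formed by the segments from $(q_i,p_i)$ to $(q_i,p_{i+1})$ and from $(q_i,p_{i+1})$ to $(q_{i+1},p_{i+1})$, for all $i$. Let $\xi_T(K)$ be the minimum of $\ell_T(x_1,\dots,x_m)$ over all $m\ge2$ and all closed polygonal lines $(x_1,\dots,x_m)$ whose vertices do not all lie in one translate of $\operatorname{int}K$. **Corollary.** Let $H\subset\mathbb R^n$ be a Hanner polytope, let $(q,p)\in\partial(H\times H^\circ)$, and let $U$ be any neighborhood of $(q,p)$ in $\mathbb R^n\times\mathbb R^n$. Then there is a closed classical billiard trajectory in $H\times H^\circ$ whose phase-space curve meets $U$ and which has minimal length: its length equals $\xi_{H^\circ}(H)$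 (the minimum being attained), and no closed classical billiard trajectory in $H\times H^\circ$ is shorter. -/

import Mathlib

open scoped Topology

namespace Billiard

/-- The (one-sided) polar body of `K`; `V = ℝⁿ` and its dual are paired by the dot product. -/
def polarBody {n : ℕ} (K : Set (Fin n → ℝ)) : Set (Fin n → ℝ) :=
  {p | ∀ q ∈ K, dotProduct p q ≤ 1}

/-- `‖x‖_T = max_{p ∈ T} ⟨p, x⟩`, the (possibly non-symmetric) norm whose unit ball is the
polar of `T`. -/
noncomputable def finslerNorm {n : ℕ} (T : Set (Fin n → ℝ)) (x : Fin n → ℝ) : ℝ :=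
  sSup ((fun p => dotProduct p x) '' T)

/-- `K ⊕₁ L`: the unit body of `‖·‖⁽¹⁾ + ‖·‖⁽²⁾`, where `K` and `L` are the unit bodies of
the two norms. -/
def sumOne {k l : ℕ} (K : Set (Fin k → ℝ)) (L : Set (Fin l → ℝ)) : Set (Fin (k + l) → ℝ) :=
  {x | gauge K (fun i => x (Fin.castAdd l i)) + gauge L (fun j => x (Fin.natAdd k j)) ≤ 1}

/-- `K ⊕_∞ L`: the unit body of `max {‖·‖⁽¹⁾, ‖·‖⁽²⁾}`. -/
def sumInfty {k l : ℕ} (K : Set (Fin k → ℝ)) (L : Set (Fin l → ℝ)) : Set (Fin (k + l) → ℝ) :=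
  {x | max (gauge K (fun i => x (Fin.castAdd l i))) (gauge L (fun j => x (Fin.natAdd k j))) ≤ 1}

/-- Hanner polytopes: the segment `[-1, 1]` in dimension one, and everything obtained from it
by iterating the direct sums `⊕₁` and `⊕_∞`. -/
inductive IsHanner : (n : ℕ) → Set (Fin n → ℝ) → Prop
  | segment : IsHanner 1 {x | x 0 ∈ Set.Icc (-1 : ℝ) 1}
  | one {k l : ℕ} {K : Set (Fin k → ℝ)} {L : Set (Fin l → ℝ)} :
      IsHanner k K → IsHanner l L → IsHanner (k + l) (sumOne K L)
  | infty {k l : ℕ} {K : Set (Fin k → ℝ)} {L : Set (Fin l → ℝ)} :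
      IsHanner k K → IsHanner l L → IsHanner (k + l) (sumInfty K L)

/-- The smooth piece of `∂K`: the boundary points at which the norm `‖·‖_{K°}` with unit body
`K` is differentiable. For a polytope these are the relative interiors of the facets. -/
def smoothBoundary {n : ℕ} (K : Set (Fin n → ℝ)) : Set (Fin n → ℝ) :=
  {q | q ∈ frontier K ∧ DifferentiableAt ℝ (finslerNorm (polarBody K)) q}

/-- The outer normal `n_K(q) = d‖q‖_{K°}`, as a vector of partial derivatives. It is only
used at points of `smoothBoundary K`. -/
noncomputable def outerNormal {n : ℕ} (K : Set (Fin n → ℝ)) (q : Fin n → ℝ) : Fin n → ℝ :=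
  fun i => fderiv ℝ (finslerNorm (polarBody K)) q (Pi.single i 1)

/-- The length `∑ ‖q_{i+1} - q_i‖_T` of a closed polygonal line; `finRotate m` is the cyclic
successor `i ↦ i + 1` on `Fin m`. -/
noncomputable def closedLength {n m : ℕ} (T : Set (Fin n → ℝ)) (q : Fin m → Fin n → ℝ) : ℝ :=
  ∑ i, finslerNorm T (q (finRotate m i) - q i)

/-- `𝒫_m(K)`: the `m`-tuples that do not fit into any translate of the interior of `K`. -/
def nonTranslatable {n : ℕ} (K : Set (Fin n → ℝ)) (m : ℕ) : Set (Fin m → Fin n → ℝ) :=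
  {q | ¬ ∃ t : Fin n → ℝ, ∀ i, q i - t ∈ interior K}

/-- The lengths of all closed polygonal lines with at least two vertices that do not fit into a
translate of the interior of `K`. The minimum of this set is `ξ_T(K)`. -/
def candidateLengths {n : ℕ} (K T : Set (Fin n → ℝ)) : Set ℝ :=
  {s | ∃ m : ℕ, 2 ≤ m ∧ ∃ q ∈ nonTranslatable K m, closedLength T q = s}

/-- A closed classical billiard trajectory in `K × T` with bounce points `q i` and momenta
`p i`. The momentum `p (i + 1)` is the one on the way from `q i` to `q (i + 1)`. All bounce
points and momenta are in the smooth pieces of the boundaries, the velocity is a positive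
multiple of `n_T(p)`, and `p' - p = -λ n_K(q)` with `λ > 0` at each bounce. -/
structure IsClassicalTrajectory {n m : ℕ} (K T : Set (Fin n → ℝ))
    (q p : Fin m → Fin n → ℝ) : Prop where
  two_le : 2 ≤ m
  coord_mem : ∀ i, q i ∈ smoothBoundary K
  momentum_mem : ∀ i, p i ∈ smoothBoundary T
  motion : ∀ i, ∃ μ : ℝ, 0 < μ ∧
    q (finRotate m i) - q i = μ • outerNormal T (p (finRotate m i))
  reflection : ∀ i, ∃ r : ℝ, 0 < r ∧
    p (finRotate m i) - p i = -(r • outerNormal K (q i))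

/-- The closed curve in phase space traced by a trajectory: the point moves from `q i` to
`q (i + 1)` with momentum `p (i + 1)`, and during the bounce at `q i` the momentum moves along
the segment from `p i` to `p (i + 1)`. -/
def phaseCurve {n m : ℕ} (q p : Fin m → Fin n → ℝ) : Set ((Fin n → ℝ) × (Fin n → ℝ)) :=
  ⋃ i, (segment ℝ (q i, p (finRotate m i)) (q (finRotate m i), p (finRotate m i)) ∪
    segment ℝ (q i, p i) (q i, p (finRotate m i)))

end Billiard

/-!
Every phase point of a Hanner polytope is a sum over a zigzag, a word `w₀ v₀ w₁ v₁ ⋯ v_{N-1} w_N` of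
points `wⱼ` of `H°` and `vᵢ` of `H` in which `wⱼ` and `vᵢ` pair to `1` if `wⱼ` comes first and to
`-1` otherwise: `p = ∑ sⱼ wⱼ` and `q = ∑ tᵢ vᵢ` with nonnegative weights, where `∑ tᵢ = ‖q‖` and
`∑ sⱼ` is any number `≥ ‖p‖`. In dimension one the word is `(e, e, -e)`. For `⊕₁` the words of the
factors are merged: the letters `v` are kept, and the letters `w`, as vertices of a product, are
added. For `⊕_∞` the same is done after cutting off the first and the last letter of one of the
words, which exchanges the roles of `v` and `w` in it.

When `N = n` the `vᵢ` form a basis and `w_n = -w₀`. Continued antiperiodically, the letters give a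
closed trajectory with `2n` bounces: the bounce point `q_j = t_j v_j + ⋯ + t_{j+n-1} v_{j+n-1}` is
inside the facet with normal `w_j`, the next one is obtained by replacing `t_j v_j` by `-t_j v_j`,
and the momenta behave in the same way. Its length is `4 ∑ tᵢ = 4`, and after a small change of the
weights, which makes them positive, its curve passes near the prescribed phase point.

No admissible closed polygonal line is shorter: one of length `L` is contained in a ball of radius
`L / 4`, centred at the midpoint of two of its points which halve the length.
-/

namespace Billiard

open scoped Matrix Pointwise

/-! ### Polar bodies -/

section PolarBody

variable {n : ℕ} {K : Set (Fin n → ℝ)}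

theorem convex_polarBody : Convex ℝ (polarBody K) := by
  intro p hp p' hp' a b ha hb hab q hq
  rw [add_dotProduct, smul_dotProduct, smul_dotProduct, smul_eq_mul, smul_eq_mul]
  calc a * (p ⬝ᵥ q) + b * (p' ⬝ᵥ q) ≤ a * 1 + b * 1 := by
        gcongr
        exacts [hp q hq, hp' q hq]
    _ = 1 := by rw [mul_one, mul_one, hab]

theorem isClosed_polarBody : IsClosed (polarBody K) := by
  simp only [polarBody, Set.ofPred_forall]
  exact isClosed_biInter fun q _ => isClosed_le (by fun_prop) continuous_const

theorem dotProduct_le_gauge (hK : Absorbent ℝ K) {p : Fin n → ℝ} (hp : p ∈ polarBody K)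
    (x : Fin n → ℝ) : p ⬝ᵥ x ≤ gauge K x := by
  refine le_of_forall_pos_le_add fun ε hε => ?_
  obtain ⟨r, hr, hrε, y, hy, rfl⟩ := exists_lt_of_gauge_lt hK (lt_add_of_pos_right (gauge K x) hε)
  dsimp only
  rw [dotProduct_smul, smul_eq_mul]
  exact (mul_le_of_le_one_right hr.le (hp y hy)).trans hrε.le

theorem exists_mem_polarBody_dotProduct_eq_gauge (hK : Convex ℝ K) (habs : Absorbent ℝ K)
    (x : Fin n → ℝ) : ∃ p ∈ polarBody K, p ⬝ᵥ x = gauge K x := by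
  have hzero : ∀ c : ℝ, c • x = 0 → c • gauge K x = 0 := by
    intro c hc
    rcases smul_eq_zero.1 hc with rfl | rfl
    · rw [zero_smul]
    · rw [gauge_zero, smul_zero]
  obtain ⟨g, hgx, hgK⟩ := exists_extension_of_le_sublinear
    (LinearPMap.mkSpanSingleton' (σ := RingHom.id ℝ) x (gauge K x) hzero) (gauge K)
    (fun c hc y => gauge_smul_of_nonneg hc.le y) (gauge_add_le hK habs) (by
      rintro ⟨y, hy⟩
      obtain ⟨c, rfl⟩ := Submodule.mem_span_singleton.1 hy
      rw [LinearPMap.mkSpanSingleton'_apply, RingHom.id_apply]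
      rcases le_total 0 c with hc | hc
      · exact (gauge_smul_of_nonneg hc x).ge
      · exact (mul_nonpos_of_nonpos_of_nonneg hc (gauge_nonneg x)).trans (gauge_nonneg _))
  obtain ⟨p, rfl⟩ := (dotProductEquiv ℝ (Fin n)).surjective g
  refine ⟨p, fun y hy => (hgK y).trans (gauge_le_one_of_mem hy), ?_⟩
  exact (hgx ⟨x, Submodule.mem_span_singleton_self x⟩).trans
    (LinearPMap.mkSpanSingleton'_apply_self ..)

end PolarBody

/-- `K` and `K'` are symmetric convex bodies with the origin in their interior, each of which is
the polar of the other. -/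
structure IsPolarPair {n : ℕ} (K K' : Set (Fin n → ℝ)) : Prop where
  polar_left : polarBody K = K'
  polar_right : polarBody K' = K
  neg_mem : ∀ x ∈ K, -x ∈ K
  nhds_left : K ∈ 𝓝 0
  nhds_right : K' ∈ 𝓝 0

namespace IsPolarPair

variable {n : ℕ} {K K' : Set (Fin n → ℝ)} (h : IsPolarPair K K')

include h

theorem symm : IsPolarPair K' K where
  polar_left := h.polar_right
  polar_right := h.polar_left
  neg_mem p hp := by
    rw [← h.polar_left] at hp ⊢
    intro q hq
    rw [neg_dotProduct, ← dotProduct_neg]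
    exact hp _ (h.neg_mem q hq)
  nhds_left := h.nhds_right
  nhds_right := h.nhds_left

theorem neg_image {ι : Type*} (f : (Fin n → ℝ) →ₗ[ℝ] ι → ℝ) : -(f '' K) = f '' K := by
  have hK : -K = K := Set.Subset.antisymm (fun x hx => neg_neg x ▸ h.neg_mem _ hx) fun x hx =>
    h.neg_mem x hx
  rw [← Set.image_neg_of_apply_neg_eq_neg fun x _ => map_neg f x, hK]

theorem convex : Convex ℝ K := h.polar_right ▸ convex_polarBody

theorem isClosed : IsClosed K := h.polar_right ▸ isClosed_polarBody

theorem absorbent : Absorbent ℝ K := absorbent_nhds_zero h.nhds_left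

theorem mem_iff_gauge_le_one {x : Fin n → ℝ} : x ∈ K ↔ gauge K x ≤ 1 := by
  rw [gauge_le_one_iff_mem_closure h.convex h.nhds_left, h.isClosed.closure_eq]

theorem mem_interior_iff {x : Fin n → ℝ} : x ∈ interior K ↔ gauge K x < 1 :=
  (gauge_lt_one_iff_mem_interior h.convex h.nhds_left).symm

theorem mem_frontier_iff {x : Fin n → ℝ} : x ∈ frontier K ↔ gauge K x = 1 :=
  (gauge_eq_one_iff_mem_frontier h.convex h.nhds_left).symm

theorem continuous_gauge : Continuous (gauge K) := _root_.continuous_gauge h.convex h.nhds_left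

theorem gauge_neg (x : Fin n → ℝ) : gauge K (-x) = gauge K x := _root_.gauge_neg h.neg_mem x

theorem dotProduct_le {p : Fin n → ℝ} (hp : p ∈ K') (x : Fin n → ℝ) : p ⬝ᵥ x ≤ gauge K x :=
  dotProduct_le_gauge h.absorbent (h.polar_left ▸ hp) x

theorem exists_dotProduct_eq_gauge (x : Fin n → ℝ) : ∃ p ∈ K', p ⬝ᵥ x = gauge K x :=
  h.polar_left ▸ exists_mem_polarBody_dotProduct_eq_gauge h.convex h.absorbent x

theorem finslerNorm_eq_gauge : finslerNorm K' = gauge K := by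
  ext x
  obtain ⟨p, hp, hpx⟩ := h.exists_dotProduct_eq_gauge x
  refine IsGreatest.csSup_eq ⟨⟨p, hp, hpx⟩, ?_⟩
  rintro _ ⟨p', hp', rfl⟩
  exact h.dotProduct_le hp' x

end IsPolarPair

/-! ### Direct sums -/

section DirectSum

variable {k l : ℕ}

/-- The projection of `ℝ^(k+l)` to the first factor of `ℝ^k × ℝ^l`. -/
def fst : (Fin (k + l) → ℝ) →ₗ[ℝ] Fin k → ℝ := LinearMap.funLeft ℝ ℝ (Fin.castAdd l)

/-- The projection of `ℝ^(k+l)` to the second factor of `ℝ^k × ℝ^l`. -/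
def snd : (Fin (k + l) → ℝ) →ₗ[ℝ] Fin l → ℝ := LinearMap.funLeft ℝ ℝ (Fin.natAdd k)

/-- The inclusion of the first factor into `ℝ^(k+l) = ℝ^k × ℝ^l`. -/
def inl : (Fin k → ℝ) →ₗ[ℝ] Fin (k + l) → ℝ where
  toFun x := Fin.append x 0
  map_add' x y := by ext i; refine Fin.addCases (fun _ => ?_) (fun _ => ?_) i <;> simp
  map_smul' c x := by ext i; refine Fin.addCases (fun _ => ?_) (fun _ => ?_) i <;> simp

/-- The inclusion of the second factor into `ℝ^(k+l) = ℝ^k × ℝ^l`. -/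
def inr : (Fin l → ℝ) →ₗ[ℝ] Fin (k + l) → ℝ where
  toFun x := Fin.append 0 x
  map_add' x y := by ext i; refine Fin.addCases (fun _ => ?_) (fun _ => ?_) i <;> simp
  map_smul' c x := by ext i; refine Fin.addCases (fun _ => ?_) (fun _ => ?_) i <;> simp

@[simp] theorem fst_inl (x : Fin k → ℝ) : fst (inl x : Fin (k + l) → ℝ) = x :=
  funext fun i => Fin.append_left x 0 i

@[simp] theorem snd_inl (x : Fin k → ℝ) : snd (inl x : Fin (k + l) → ℝ) = 0 :=
  funext fun i => Fin.append_right x 0 i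

@[simp] theorem fst_inr (x : Fin l → ℝ) : fst (inr x : Fin (k + l) → ℝ) = 0 :=
  funext fun i => Fin.append_left 0 x i

@[simp] theorem snd_inr (x : Fin l → ℝ) : snd (inr x : Fin (k + l) → ℝ) = x :=
  funext fun i => Fin.append_right 0 x i

theorem inl_fst_add_inr_snd (x : Fin (k + l) → ℝ) : inl (fst x) + inr (snd x) = x := by
  ext i
  refine Fin.addCases (fun _ => ?_) (fun _ => ?_) i <;> simp [inl, inr, fst, snd]

theorem dotProduct_eq_fst_add_snd (p x : Fin (k + l) → ℝ) :
    p ⬝ᵥ x = fst p ⬝ᵥ fst x + snd p ⬝ᵥ snd x :=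
  Fin.sum_univ_add _

theorem continuous_fst : Continuous (fst : (Fin (k + l) → ℝ) → Fin k → ℝ) :=
  fst.continuous_of_finiteDimensional

theorem continuous_snd : Continuous (snd : (Fin (k + l) → ℝ) → Fin l → ℝ) :=
  snd.continuous_of_finiteDimensional

variable {K K' : Set (Fin k → ℝ)} {L L' : Set (Fin l → ℝ)}

theorem mem_sumOne {x : Fin (k + l) → ℝ} :
    x ∈ sumOne K L ↔ gauge K (fst x) + gauge L (snd x) ≤ 1 := Iff.rfl

theorem mem_sumInfty {x : Fin (k + l) → ℝ} :
    x ∈ sumInfty K L ↔ gauge K (fst x) ≤ 1 ∧ gauge L (snd x) ≤ 1 :=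
  show max _ _ ≤ (1 : ℝ) ↔ _ from max_le_iff

theorem gauge_setOf_le_one {E : Type*} [AddCommGroup E] [Module ℝ E] {f : E → ℝ}
    (hf : ∀ x, 0 ≤ f x) (hsmul : ∀ c : ℝ, 0 ≤ c → ∀ x, f (c • x) = c * f x) (x : E) :
    gauge {y | f y ≤ 1} x = f x := by
  have hset : {r : ℝ | r ∈ Set.Ioi 0 ∧ r⁻¹ • x ∈ {y | f y ≤ 1}} = {r | 0 < r ∧ f x ≤ r} := by
    ext r
    refine and_congr_right fun hr => ?_
    rw [Set.mem_ofPred_eq, hsmul _ (inv_nonneg.2 (le_of_lt hr)), inv_mul_le_one₀ hr]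
  rw [gauge_def', hset]
  have hmem : ∀ ε : ℝ, 0 < ε → f x + ε ∈ {r | 0 < r ∧ f x ≤ r} := fun ε hε =>
    ⟨add_pos_of_nonneg_of_pos (hf x) hε, le_add_of_nonneg_right hε.le⟩
  exact le_antisymm
    (le_of_forall_pos_le_add fun ε hε => csInf_le ⟨0, fun r hr => hr.1.le⟩ (hmem ε hε))
    (le_csInf ⟨_, hmem 1 one_pos⟩ fun r hr => hr.2)

theorem gauge_sumOne (x : Fin (k + l) → ℝ) :
    gauge (sumOne K L) x = gauge K (fst x) + gauge L (snd x) := by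
  refine gauge_setOf_le_one (f := fun x => gauge K (fst x) + gauge L (snd x))
    (fun x => add_nonneg (gauge_nonneg _) (gauge_nonneg _)) (fun c hc x => ?_) x
  simp only [map_smul, gauge_smul_of_nonneg hc, smul_eq_mul, mul_add]

theorem gauge_sumInfty (x : Fin (k + l) → ℝ) :
    gauge (sumInfty K L) x = max (gauge K (fst x)) (gauge L (snd x)) := by
  refine gauge_setOf_le_one (f := fun x => max (gauge K (fst x)) (gauge L (snd x)))
    (fun x => le_max_of_le_left (gauge_nonneg _)) (fun c hc x => ?_) x
  simp only [map_smul, gauge_smul_of_nonneg hc, smul_eq_mul, mul_max_of_nonneg _ _ hc]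

theorem IsPolarPair.polarBody_sumOne (hK : IsPolarPair K K') (hL : IsPolarPair L L') :
    polarBody (sumOne K L) = sumInfty K' L' := by
  ext p
  rw [mem_sumInfty, ← hK.symm.mem_iff_gauge_le_one, ← hL.symm.mem_iff_gauge_le_one]
  refine ⟨fun hp => ⟨?_, ?_⟩, fun ⟨hp₁, hp₂⟩ q hq => ?_⟩
  · rw [← hK.polar_left]
    intro q hq
    have hmem : inl q ∈ sumOne K L := by
      simpa [mem_sumOne] using hK.mem_iff_gauge_le_one.1 hq
    simpa [dotProduct_eq_fst_add_snd] using hp _ hmem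
  · rw [← hL.polar_left]
    intro q hq
    have hmem : inr q ∈ sumOne K L := by
      simpa [mem_sumOne] using hL.mem_iff_gauge_le_one.1 hq
    simpa [dotProduct_eq_fst_add_snd] using hp _ hmem
  · rw [dotProduct_eq_fst_add_snd]
    exact (add_le_add (hK.dotProduct_le hp₁ _) (hL.dotProduct_le hp₂ _)).trans hq

theorem IsPolarPair.polarBody_sumInfty (hK : IsPolarPair K K') (hL : IsPolarPair L L') :
    polarBody (sumInfty K' L') = sumOne K L := by
  ext q
  refine ⟨fun hq => ?_, fun hq p hp => ?_⟩
  · obtain ⟨p₁, hp₁, hpq₁⟩ := hK.exists_dotProduct_eq_gauge (fst q)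
    obtain ⟨p₂, hp₂, hpq₂⟩ := hL.exists_dotProduct_eq_gauge (snd q)
    have hmem : inl p₁ + inr p₂ ∈ sumInfty K' L' := by
      simpa [mem_sumInfty] using
        ⟨hK.symm.mem_iff_gauge_le_one.1 hp₁, hL.symm.mem_iff_gauge_le_one.1 hp₂⟩
    have hpq := hq _ hmem
    rw [dotProduct_comm, dotProduct_eq_fst_add_snd] at hpq
    simpa [mem_sumOne, hpq₁, hpq₂] using hpq
  · rw [mem_sumInfty, ← hK.symm.mem_iff_gauge_le_one, ← hL.symm.mem_iff_gauge_le_one] at hp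
    rw [dotProduct_comm, dotProduct_eq_fst_add_snd]
    exact (add_le_add (hK.dotProduct_le hp.1 _) (hL.dotProduct_le hp.2 _)).trans hq

theorem isPolarPair_sumOne (hK : IsPolarPair K K') (hL : IsPolarPair L L') :
    IsPolarPair (sumOne K L) (sumInfty K' L') where
  polar_left := hK.polarBody_sumOne hL
  polar_right := hK.polarBody_sumInfty hL
  neg_mem x hx := by
    rwa [mem_sumOne, map_neg, map_neg, hK.gauge_neg, hL.gauge_neg]
  nhds_left := by
    have hcont : Continuous fun x : Fin (k + l) → ℝ => gauge K (fst x) + gauge L (snd x) :=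
      (hK.continuous_gauge.comp continuous_fst).add (hL.continuous_gauge.comp continuous_snd)
    exact hcont.continuousAt.preimage_mem_nhds (Iic_mem_nhds (by simp [gauge_zero]))
  nhds_right := by
    have hcont : Continuous fun x : Fin (k + l) → ℝ => max (gauge K' (fst x)) (gauge L' (snd x)) :=
      (hK.symm.continuous_gauge.comp continuous_fst).max
        (hL.symm.continuous_gauge.comp continuous_snd)
    exact hcont.continuousAt.preimage_mem_nhds (Iic_mem_nhds (by simp [gauge_zero]))

end DirectSum

section Segment

theorem gauge_Icc_segment (x : Fin 1 → ℝ) :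
    gauge {y : Fin 1 → ℝ | y 0 ∈ Set.Icc (-1 : ℝ) 1} x = |x 0| := by
  simp only [Set.mem_Icc, ← abs_le]
  exact gauge_setOf_le_one (f := fun y : Fin 1 → ℝ => |y 0|) (fun _ => abs_nonneg _)
    (fun c hc y => by simp [abs_mul, abs_of_nonneg hc]) x

theorem polarBody_segment : polarBody {x : Fin 1 → ℝ | x 0 ∈ Set.Icc (-1 : ℝ) 1} =
    {x | x 0 ∈ Set.Icc (-1 : ℝ) 1} := by
  ext p
  simp only [polarBody, dotProduct, Fin.sum_univ_one, Set.mem_ofPred_eq, Set.mem_Icc]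
  refine ⟨fun hp => ⟨?_, ?_⟩, fun hp q hq => ?_⟩
  · have := hp (fun _ => -1) (by norm_num)
    linarith
  · have := hp (fun _ => 1) (by norm_num)
    linarith
  · rw [← abs_le] at hp hq
    exact (le_abs_self _).trans (abs_mul (p 0) (q 0) ▸ mul_le_one₀ hp (abs_nonneg _) hq)

theorem isPolarPair_segment : IsPolarPair {x : Fin 1 → ℝ | x 0 ∈ Set.Icc (-1 : ℝ) 1}
    {x : Fin 1 → ℝ | x 0 ∈ Set.Icc (-1 : ℝ) 1} where
  polar_left := polarBody_segment
  polar_right := polarBody_segment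
  neg_mem x hx := ⟨neg_le_neg hx.2, neg_le.1 hx.1⟩
  nhds_left := (continuous_apply 0).continuousAt.preimage_mem_nhds
    (Icc_mem_nhds (by norm_num) (by norm_num))
  nhds_right := (continuous_apply 0).continuousAt.preimage_mem_nhds
    (Icc_mem_nhds (by norm_num) (by norm_num))

end Segment

/-! ### Zigzags -/

/-- `IsZigzag A B N p σ q τ`: there are letters `a₀, …, a_N ∈ A` and `b₀, …, b_{N-1} ∈ B` with
`⟨a_j, b_i⟩ = 1` for `j ≤ i` and `⟨a_j, b_i⟩ = -1` for `j > i`, and nonnegative weights `s_j`, `t_i`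
such that `p = ∑ s_j a_j`, `σ = ∑ s_j`, `q = ∑ t_i b_i` and `τ = ∑ t_i`. The letters are arranged in
the word `a₀ b₀ a₁ b₁ ⋯ b_{N-1} a_N`, from which the constructor `step` splits off `a₀ b₀`. -/
inductive IsZigzag {ι : Type*} [Fintype ι] :
    Set (ι → ℝ) → Set (ι → ℝ) → ℕ → (ι → ℝ) → ℝ → (ι → ℝ) → ℝ → Prop
  | last {A B : Set (ι → ℝ)} {a : ι → ℝ} {s : ℝ} (ha : a ∈ A) (hs : 0 ≤ s) :
      IsZigzag A B 0 (s • a) s 0 0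
  | step {A B : Set (ι → ℝ)} {a b : ι → ℝ} {s t : ℝ} {N : ℕ} {p q : ι → ℝ} {σ τ : ℝ}
      (ha : a ∈ A) (hb : b ∈ B) (hab : a ⬝ᵥ b = 1) (hs : 0 ≤ s) (ht : 0 ≤ t)
      (h : IsZigzag (A ∩ {x | x ⬝ᵥ b = -1}) (B ∩ {y | a ⬝ᵥ y = 1}) N p σ q τ) :
      IsZigzag A B (N + 1) (s • a + p) (s + σ) (t • b + q) (t + τ)

namespace IsZigzag

variable {ι κ : Type*} [Fintype ι] [Fintype κ] {A A' B B' : Set (ι → ℝ)} {N N' : ℕ}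
  {p p' q q' : ι → ℝ} {σ σ' τ τ' : ℝ}

theorem mono (h : IsZigzag A B N p σ q τ) (hA : A ⊆ A') (hB : B ⊆ B') :
    IsZigzag A' B' N p σ q τ := by
  induction h generalizing A' B' with
  | last ha hs => exact last (hA ha) hs
  | step ha hb hab hs ht _ ih =>
    exact step (hA ha) (hB hb) hab hs ht
      (ih (Set.inter_subset_inter_left _ hA) (Set.inter_subset_inter_left _ hB))

theorem map (h : IsZigzag A B N p σ q τ) (f : (ι → ℝ) →ₗ[ℝ] κ → ℝ)
    (hf : ∀ x y, f x ⬝ᵥ f y = x ⬝ᵥ y) : IsZigzag (f '' A) (f '' B) N (f p) σ (f q) τ := by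
  induction h with
  | last ha hs =>
    rw [map_smul, map_zero]
    exact last (Set.mem_image_of_mem f ha) hs
  | step ha hb hab hs ht _ ih =>
    simp only [map_add, map_smul]
    refine step (Set.mem_image_of_mem f ha) (Set.mem_image_of_mem f hb) (by rwa [hf]) hs ht
      (ih.mono ?_ ?_)
    · rintro _ ⟨x, ⟨hxA, hx⟩, rfl⟩
      exact ⟨⟨x, hxA, rfl⟩, (hf _ _).trans hx⟩
    · rintro _ ⟨y, ⟨hyB, hy⟩, rfl⟩
      exact ⟨⟨y, hyB, rfl⟩, (hf _ _).trans hy⟩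

theorem nonneg_left (h : IsZigzag A B N p σ q τ) : 0 ≤ σ := by
  induction h with
  | last _ hs => exact hs
  | step _ _ _ hs _ _ ih => exact add_nonneg hs ih

theorem last_sub {a : ι → ℝ} {r s : ℝ} (ha : a ∈ A) (hrs : r ≤ s) :
    IsZigzag A B 0 (s • a - r • a) (s - r) 0 0 := by
  rw [← sub_smul]
  exact last ha (sub_nonneg.2 hrs)

theorem step_sub {a b : ι → ℝ} {r s t : ℝ} (ha : a ∈ A) (hb : b ∈ B) (hab : a ⬝ᵥ b = 1)
    (hrs : r ≤ s) (ht : 0 ≤ t)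
    (h : IsZigzag (A ∩ {x | x ⬝ᵥ b = -1}) (B ∩ {y | a ⬝ᵥ y = 1}) N p σ q τ) :
    IsZigzag A (B ∩ {y | a ⬝ᵥ y = 1}) (N + 1) (s • a + p - r • a) (s + σ - r) (t • b + q)
      (t + τ) := by
  rw [add_sub_right_comm, ← sub_smul, add_sub_right_comm]
  exact step ha ⟨hb, hab⟩ hab (sub_nonneg.2 hrs) ht (h.mono subset_rfl fun y hy => ⟨hy, hy.2⟩)

theorem step_add {a a' b : ι → ℝ} {s t : ℝ} (hBA' : ∀ x ∈ A', ∀ y ∈ B, x ⬝ᵥ y = 0)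
    (hAB' : ∀ x ∈ A, ∀ y ∈ B', x ⬝ᵥ y = 0)
    (ha : a ∈ A) (ha' : a' ∈ A') (hb : b ∈ B) (hab : a ⬝ᵥ b = 1) (hs : 0 ≤ s) (ht : 0 ≤ t)
    (h : IsZigzag (A ∩ {x | x ⬝ᵥ b = -1} + A') (B ∩ {y | a ⬝ᵥ y = 1} ∪ B' ∩ {y | a' ⬝ᵥ y = 1})
      N (p + (p' - s • a')) σ (q + q') (τ + τ')) :
    IsZigzag (A + A') (B ∪ B') (N + 1) (s • a + p + p') (s + σ) (t • b + q + q') (t + τ + τ') := by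
  have hp : s • a + p + p' = s • (a + a') + (p + (p' - s • a')) := by
    rw [smul_add]
    abel
  rw [hp, add_assoc (t • b), add_assoc t]
  refine step (Set.add_mem_add ha ha') (Or.inl hb) ?_ hs ht (h.mono ?_ ?_)
  · rw [add_dotProduct, hab, hBA' a' ha' b hb, add_zero]
  · rintro _ ⟨x, ⟨hxA, hx⟩, x', hx', rfl⟩
    refine ⟨Set.add_mem_add hxA hx', ?_⟩
    rw [Set.mem_ofPred_eq, add_dotProduct, hx, hBA' x' hx' b hb, add_zero]
  · rintro y (⟨hyB, hy⟩ | ⟨hyB', hy⟩)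
    · refine ⟨Or.inl hyB, ?_⟩
      rw [Set.mem_ofPred_eq, add_dotProduct, hy, hBA' a' ha' y hyB, add_zero]
    · refine ⟨Or.inr hyB', ?_⟩
      rw [Set.mem_ofPred_eq, add_dotProduct, hy, hAB' a ha y hyB', zero_add]

/-- The words are merged like two sorted lists: the smaller of the two leading weights is used up,
and the other leading letter stays in front with the remaining weight. -/
theorem add (h : IsZigzag A B N p σ q τ) (h' : IsZigzag A' B' N' p' σ' q' τ')
    (hσ : σ = σ') (hBA' : ∀ x ∈ A', ∀ y ∈ B, x ⬝ᵥ y = 0)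
    (hAB' : ∀ x ∈ A, ∀ y ∈ B', x ⬝ᵥ y = 0) :
    IsZigzag (A + A') (B ∪ B') (N + N') (p + p') σ (q + q') (τ + τ') := by
  induction hM : N + N' generalizing A A' B B' N N' p p' q q' σ σ' τ τ' with
  | zero =>
    obtain ⟨rfl, rfl⟩ : N = 0 ∧ N' = 0 := by omega
    cases h with | last ha hs =>
    cases h' with | last ha' _ =>
    rw [← hσ, ← smul_add, add_zero, add_zero]
    exact last (Set.add_mem_add ha ha') hs
  | succ M ih =>
    cases h with
    | last ha hs =>
      cases h' with
      | last => omega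
      | step ha' hb' hab' hs' ht' h' =>
        convert step_add hAB' hBA' ha' ha hb' hab' hs' ht'
          (ih h' (last_sub (s := σ) ha (by linarith [h'.nonneg_left])) (by linarith)
            (fun x hx y hy => hAB' x hx y hy.1) (fun x hx y hy => hBA' x hx.1 y hy.1)
            (by omega)) using 1
        exacts [add_comm _ _, Set.union_comm _ _, add_comm _ _, add_comm _ _, add_comm _ _]
    | @step _ _ _ _ s _ _ _ _ _ _ ha hb hab hs ht h =>
      cases h' with
      | last ha' hs' =>
        exact step_add hBA' hAB' ha ha' hb hab hs ht
          (ih h (last_sub ha' (by linarith [h.nonneg_left])) (by linarith)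
            (fun x hx y hy => hBA' x hx y hy.1) (fun x hx y hy => hAB' x hx.1 y hy.1) (by omega))
      | @step _ _ _ _ s' _ _ _ _ _ _ ha' hb' hab' hs' ht' h' =>
        rcases le_total s s' with hss | hss
        · exact step_add hBA' hAB' ha ha' hb hab hs ht
            (ih h (step_sub ha' hb' hab' hss ht' h') (by linarith)
              (fun x hx y hy => hBA' x hx y hy.1) (fun x hx y hy => hAB' x hx.1 y hy.1) (by omega))
        · convert step_add hAB' hBA' ha' ha hb' hab' hs' ht'
            (ih h' (step_sub ha hb hab hss ht h) (by linarith)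
              (fun x hx y hy => hAB' x hx y hy.1) (fun x hx y hy => hBA' x hx.1 y hy.1)
              (by omega)) using 1
          exacts [add_comm _ _, Set.union_comm _ _, add_comm _ _, add_comm _ _, add_comm _ _]

theorem dual (h : IsZigzag A B (N + 1) p σ q τ) :
    ∃ a ∈ A, ∃ a' ∈ A, ∃ s s' : ℝ, 0 ≤ s ∧ 0 ≤ s' ∧
      IsZigzag (B ∩ {y | a ⬝ᵥ y = 1} ∩ {y | a' ⬝ᵥ y = -1}) (-A) N q τ
        (s • a + s' • a' - p) (σ - s - s') := by
  induction N generalizing A B p σ q τ with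
  | zero =>
    cases h with | step ha hb hab hs ht h =>
    cases h with | last ha' hs' =>
    refine ⟨_, ha, _, ha'.1, _, _, hs, hs', ?_⟩
    rw [sub_self, add_sub_cancel_left, sub_self, add_zero, add_zero]
    exact last ⟨⟨hb, hab⟩, ha'.2⟩ ht
  | succ N ih =>
    cases h with | @step _ _ a b s t _ p q σ τ ha hb hab hs ht h =>
    obtain ⟨a₁, ha₁, a', ha', s₁, s', hs₁, hs', h⟩ := ih h
    refine ⟨a, ha, a', ha'.1, s, s', hs, hs', ?_⟩
    have hvec : s • a + s' • a' - (s • a + p) = s₁ • -a₁ + (s₁ • a₁ + s' • a' - p) := by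
      rw [smul_neg]
      abel
    have hwt : s + σ - s - s' = s₁ + (σ - s₁ - s') := by ring
    rw [hvec, hwt]
    refine step ⟨⟨hb, hab⟩, ha'.2⟩ (by simpa using ha₁.1) ?_ ht hs₁ (h.mono ?_ ?_)
    · rw [dotProduct_neg, dotProduct_comm, ha₁.2, neg_neg]
    · rintro y ⟨⟨⟨hyB, hya⟩, hya₁⟩, hya'⟩
      refine ⟨⟨⟨hyB, hya⟩, hya'⟩, ?_⟩
      rw [Set.mem_ofPred_eq, dotProduct_neg, dotProduct_comm, hya₁]
    · rintro x ⟨hxA, hx⟩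
      refine ⟨hxA, ?_⟩
      rw [Set.mem_ofPred_eq, dotProduct_comm, ← neg_neg (x ⬝ᵥ b), ← neg_dotProduct, hx, neg_neg]

theorem sandwich (h : IsZigzag B A' N q τ p σ) {a a' : ι → ℝ} {s s' : ℝ} (hA : ∀ x ∈ A', -x ∈ A)
    (ha : a ∈ A) (ha' : a' ∈ A) (haB : ∀ y ∈ B, a ⬝ᵥ y = 1) (haB' : ∀ y ∈ B, a' ⬝ᵥ y = -1)
    (hs : 0 ≤ s) (hs' : 0 ≤ s') :
    IsZigzag A B (N + 1) (s • a + s' • a' - p) (s + s' + σ) q τ := by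
  induction h generalizing A a s with
  | @last B A' b t hb ht =>
    have := step ha hb (haB b hb) hs ht
      (last (A := A ∩ {x | x ⬝ᵥ b = -1}) (B := B ∩ {y | a ⬝ᵥ y = 1}) ⟨ha', haB' b hb⟩ hs')
    simpa using this
  | @step B A' b x t u N q p τ σ hb hx hbx ht hu _ ih =>
    have hvec : s • a + s' • a' - (u • x + p) = s • a + (u • -x + s' • a' - p) := by
      rw [smul_neg]
      abel
    have hwt : s + s' + (u + σ) = s + (u + s' + σ) := by ring
    rw [hvec, hwt]
    refine step ha hb (haB b hb) hs ht ((ih ?_ ?_ ?_ ?_ ?_ hu).mono subset_rfl ?_)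
    · intro y hy
      refine ⟨hA y hy.1, ?_⟩
      rw [Set.mem_ofPred_eq, neg_dotProduct, dotProduct_comm, hy.2]
    · refine ⟨hA x hx, ?_⟩
      rw [Set.mem_ofPred_eq, neg_dotProduct, dotProduct_comm, hbx]
    · exact ⟨ha', haB' b hb⟩
    · intro y hy
      rw [neg_dotProduct, dotProduct_comm, hy.2, neg_neg]
    · exact fun y hy => haB' y hy.1
    · exact fun y hy => ⟨hy.1, haB y hy.1⟩

/-- A zigzag without its first and last letter is, up to signs, a zigzag with the roles of the two
kinds of letters exchanged. In this form the two can be merged, and then the two letters are put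
back. -/
theorem add_dual (hN : 0 < N) (h : IsZigzag A B N p σ q τ) (h' : IsZigzag B' A' N' q' τ p' σ')
    (hAB' : ∀ x ∈ A, ∀ y ∈ B', x ⬝ᵥ y = 0) (hBA' : ∀ x ∈ A', ∀ y ∈ B, x ⬝ᵥ y = 0) :
    IsZigzag (A ∪ -A') (B + B') (N + N') (p - p') (σ + σ') (q + q') τ := by
  obtain ⟨N, rfl⟩ := Nat.exists_eq_add_one_of_ne_zero hN.ne'
  obtain ⟨a, ha, a', ha', s, s', hs, hs', hd⟩ := h.dual
  have hsum := hd.add h' rfl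
    (fun y hy x hx => by
      rw [dotProduct_comm, ← neg_eq_zero, ← neg_dotProduct]
      exact hAB' _ hx y hy)
    (fun y hy x hx => by
      rw [dotProduct_comm]
      exact hBA' x hx y hy.1.1)
  have hword := (hsum.sandwich (A := A ∪ -A') (s := s) (s' := s') ?_ (Or.inl ha) (Or.inl ha')
    ?_ ?_ hs hs').mono subset_rfl
      (Set.add_subset_add_right (Set.inter_subset_left.trans Set.inter_subset_left))
  · convert hword using 1
    · omega
    · abel
    · ring
  · rintro x (hx | hx)
    · exact Or.inl hx
    · exact Or.inr (by rwa [Set.mem_neg, neg_neg])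
  · rintro _ ⟨y, hy, y', hy', rfl⟩
    rw [dotProduct_add, hy.1.2, hAB' a ha y' hy', add_zero]
  · rintro _ ⟨y, hy, y', hy', rfl⟩
    rw [dotProduct_add, hy.2, hAB' a' ha' y' hy', add_zero]

end IsZigzag

/-- Every pair `(q, p)` is spanned by a zigzag between the two bodies, as economically as possible
in `K` and with any admissible budget in `K'`. -/
def ZigzagSpanned {n : ℕ} (K K' : Set (Fin n → ℝ)) : Prop :=
  ∀ q p σ, gauge K' p ≤ σ → IsZigzag K' K n p σ q (gauge K q)

theorem inl_dotProduct_inl {k l : ℕ} (x y : Fin k → ℝ) :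
    (inl x : Fin (k + l) → ℝ) ⬝ᵥ inl y = x ⬝ᵥ y := by
  simp [dotProduct_eq_fst_add_snd]

theorem inr_dotProduct_inr {k l : ℕ} (x y : Fin l → ℝ) :
    (inr x : Fin (k + l) → ℝ) ⬝ᵥ inr y = x ⬝ᵥ y := by
  simp [dotProduct_eq_fst_add_snd]

theorem inl_dotProduct_inr {k l : ℕ} (x : Fin k → ℝ) (y : Fin l → ℝ) :
    (inl x : Fin (k + l) → ℝ) ⬝ᵥ inr y = 0 := by
  simp [dotProduct_eq_fst_add_snd]

theorem zigzagSpanned_segment : ZigzagSpanned {x : Fin 1 → ℝ | x 0 ∈ Set.Icc (-1 : ℝ) 1}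
    {x : Fin 1 → ℝ | x 0 ∈ Set.Icc (-1 : ℝ) 1} := by
  intro q p σ hσ
  rw [gauge_Icc_segment] at hσ ⊢
  obtain ⟨e, he, heq⟩ : ∃ e : ℝ, (e = 1 ∨ e = -1) ∧ |q 0| * e = q 0 := by
    rcases abs_choice (q 0) with h | h
    · exact ⟨1, Or.inl rfl, by rw [h, mul_one]⟩
    · exact ⟨-1, Or.inr rfl, by rw [h]; ring⟩
  have hsq : e * e = 1 := by rcases he with rfl | rfl <;> norm_num
  have habs : |p 0 * e| ≤ σ := by rcases he with rfl | rfl <;> simpa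
  obtain ⟨hlow, hupp⟩ := abs_le.1 habs
  have hmem : ∀ x : ℝ, x = e ∨ x = -e → x ∈ Set.Icc (-1 : ℝ) 1 := by
    rcases he with rfl | rfl <;> rintro x (rfl | rfl) <;> norm_num
  have := IsZigzag.step (A := {x : Fin 1 → ℝ | x 0 ∈ Set.Icc (-1 : ℝ) 1})
    (B := {x : Fin 1 → ℝ | x 0 ∈ Set.Icc (-1 : ℝ) 1}) (a := fun _ => e) (b := fun _ => e)
    (s := (σ + p 0 * e) / 2) (t := |q 0|) (hmem e (Or.inl rfl)) (hmem e (Or.inl rfl))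
    (by simpa [dotProduct] using hsq) (by linarith) (abs_nonneg _)
    (IsZigzag.last (a := fun _ => -e) (s := (σ - p 0 * e) / 2)
      ⟨hmem (-e) (Or.inr rfl), by simpa [dotProduct] using hsq⟩ (by linarith))
  convert this using 1
  · ext i
    fin_cases i
    simp only [Fin.zero_eta, Fin.isValue, Pi.add_apply, Pi.smul_apply, smul_eq_mul, mul_neg]
    linear_combination -p 0 * hsq
  · ring
  · ext i
    fin_cases i
    simp [heq]
  · ring

theorem IsHanner.dim_pos {n : ℕ} {H : Set (Fin n → ℝ)} (hH : IsHanner n H) : 0 < n := by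
  induction hH with
  | segment => exact one_pos
  | one _ _ ihK _ => exact Nat.add_pos_left ihK _
  | infty _ _ ihK _ => exact Nat.add_pos_left ihK _

section DirectSum

variable {k l : ℕ} {K K' : Set (Fin k → ℝ)} {L L' : Set (Fin l → ℝ)}

theorem image_inl_union_image_inr_subset_sumOne :
    (inl '' K ∪ inr '' L : Set (Fin (k + l) → ℝ)) ⊆ sumOne K L := by
  rintro _ (⟨x, hx, rfl⟩ | ⟨y, hy, rfl⟩)
  · simpa [mem_sumOne] using gauge_le_one_of_mem hx
  · simpa [mem_sumOne] using gauge_le_one_of_mem hy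

theorem image_inl_add_image_inr_subset_sumInfty :
    (inl '' K + inr '' L : Set (Fin (k + l) → ℝ)) ⊆ sumInfty K L := by
  rintro _ ⟨_, ⟨x, hx, rfl⟩, _, ⟨y, hy, rfl⟩, rfl⟩
  simpa [mem_sumInfty] using ⟨gauge_le_one_of_mem hx, gauge_le_one_of_mem hy⟩

theorem dotProduct_eq_zero_of_mem_image_inl_of_mem_image_inr :
    ∀ x ∈ (inl '' K : Set (Fin (k + l) → ℝ)), ∀ y ∈ inr '' L, x ⬝ᵥ y = 0 := by
  rintro _ ⟨x, _, rfl⟩ _ ⟨y, _, rfl⟩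
  exact inl_dotProduct_inr x y

theorem dotProduct_eq_zero_of_mem_image_inr_of_mem_image_inl :
    ∀ y ∈ (inr '' L : Set (Fin (k + l) → ℝ)), ∀ x ∈ inl '' K, y ⬝ᵥ x = 0 := by
  intro y hy x hx
  rw [dotProduct_comm]
  exact dotProduct_eq_zero_of_mem_image_inl_of_mem_image_inr x hx y hy

theorem zigzagSpanned_sumOne (hK : ZigzagSpanned K K') (hL : ZigzagSpanned L L') :
    ZigzagSpanned (sumOne K L) (sumInfty K' L') := by
  intro q p σ hσ
  rw [gauge_sumInfty, max_le_iff] at hσ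
  have h := ((hK (fst q) (fst p) σ hσ.1).map inl inl_dotProduct_inl).add
    ((hL (snd q) (snd p) σ hσ.2).map inr inr_dotProduct_inr) rfl
    dotProduct_eq_zero_of_mem_image_inr_of_mem_image_inl
    dotProduct_eq_zero_of_mem_image_inl_of_mem_image_inr
  rw [inl_fst_add_inr_snd, inl_fst_add_inr_snd, ← gauge_sumOne] at h
  exact h.mono image_inl_add_image_inr_subset_sumInfty image_inl_union_image_inr_subset_sumOne

theorem zigzagSpanned_sumInfty (hk : 0 < k) (hl : 0 < l) (hK : IsPolarPair K K')
    (hL : IsPolarPair L L') (sK : ZigzagSpanned K K') (sK' : ZigzagSpanned K' K)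
    (sL : ZigzagSpanned L L') (sL' : ZigzagSpanned L' L) :
    ZigzagSpanned (sumInfty K L) (sumOne K' L') := by
  intro q p σ hσ
  rw [gauge_sumOne] at hσ
  rw [gauge_sumInfty]
  rcases le_total (gauge L (snd q)) (gauge K (fst q)) with hqle | hqle
  · rw [max_eq_left hqle]
    have h := ((sK (fst q) (fst p) (σ - gauge L' (snd p)) (by linarith)).map inl
      inl_dotProduct_inl).add_dual hk
      ((sL' (-snd p) (snd q) _ hqle).map inr inr_dotProduct_inr)
      dotProduct_eq_zero_of_mem_image_inl_of_mem_image_inr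
      dotProduct_eq_zero_of_mem_image_inr_of_mem_image_inl
    rw [map_neg, sub_neg_eq_add, hL.symm.gauge_neg, sub_add_cancel, inl_fst_add_inr_snd,
      inl_fst_add_inr_snd, hL.symm.neg_image] at h
    exact h.mono image_inl_union_image_inr_subset_sumOne image_inl_add_image_inr_subset_sumInfty
  · rw [max_eq_right hqle]
    have h := ((sL (snd q) (snd p) (σ - gauge K' (fst p)) (by linarith)).map inr
      inr_dotProduct_inr).add_dual hl
      ((sK' (-fst p) (fst q) _ hqle).map inl inl_dotProduct_inl)
      dotProduct_eq_zero_of_mem_image_inr_of_mem_image_inl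
      dotProduct_eq_zero_of_mem_image_inl_of_mem_image_inr
    rw [map_neg, sub_neg_eq_add, hK.symm.gauge_neg, sub_add_cancel, add_comm (inr _),
      add_comm (inr _), add_comm l, inl_fst_add_inr_snd, inl_fst_add_inr_snd, hK.symm.neg_image,
      Set.union_comm, add_comm (inr '' L)] at h
    exact h.mono image_inl_union_image_inr_subset_sumOne image_inl_add_image_inr_subset_sumInfty

theorem IsHanner.exists_polarPair {n : ℕ} {H : Set (Fin n → ℝ)} (hH : IsHanner n H) :
    ∃ H', IsPolarPair H H' ∧ ZigzagSpanned H H' ∧ ZigzagSpanned H' H := by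
  induction hH with
  | segment => exact ⟨_, isPolarPair_segment, zigzagSpanned_segment, zigzagSpanned_segment⟩
  | one hK hL ihK ihL =>
    obtain ⟨K', pK, sK, sK'⟩ := ihK
    obtain ⟨L', pL, sL, sL'⟩ := ihL
    exact ⟨_, isPolarPair_sumOne pK pL, zigzagSpanned_sumOne sK sL,
      zigzagSpanned_sumInfty hK.dim_pos hL.dim_pos pK.symm pL.symm sK' sK sL' sL⟩
  | infty hK hL ihK ihL =>
    obtain ⟨K', pK, sK, sK'⟩ := ihK
    obtain ⟨L', pL, sL, sL'⟩ := ihL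
    exact ⟨_, (isPolarPair_sumOne pK.symm pL.symm).symm,
      zigzagSpanned_sumInfty hK.dim_pos hL.dim_pos pK pL sK sK' sL sL',
      zigzagSpanned_sumOne sK' sL'⟩

end DirectSum

/-! ### Trajectories from flags -/

theorem sum_dotProduct_smul_of_biorthogonal {ι R : Type*} [Fintype ι] [DecidableEq ι] [CommRing R]
    {a b : ι → ι → R} (hab : ∀ i j, a i ⬝ᵥ b j = if i = j then 1 else 0) (x : ι → R) :
    ∑ i, (a i ⬝ᵥ x) • b i = x := by
  have hAB : Matrix.of a * (Matrix.of b)ᵀ = 1 := by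
    ext i j
    rw [Matrix.one_apply, ← hab i j]
    rfl
  calc ∑ i, (a i ⬝ᵥ x) • b i = (Matrix.of b)ᵀ *ᵥ (Matrix.of a *ᵥ x) := by
        rw [Matrix.mulVec_transpose]
        exact (Matrix.vecMul_eq_sum _ _).symm
    _ = x := by rw [Matrix.mulVec_mulVec, mul_eq_one_comm.1 hAB, Matrix.one_mulVec]

/-- The incidence pattern of the word `w₀ v₀ w₁ v₁ ⋯ v_{N-1} w_N`: a letter `w` and a letter `v`
pair to `1` if `w` comes first, and to `-1` otherwise. -/
def IsStaircase {ι : Type*} [Fintype ι] {N : ℕ} (w : Fin (N + 1) → ι → ℝ) (v : Fin N → ι → ℝ) :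
    Prop :=
  ∀ j i, w j ⬝ᵥ v i = if j ≤ i.castSucc then 1 else -1

theorem IsStaircase.cons {ι : Type*} [Fintype ι] {N : ℕ} {w : Fin (N + 1) → ι → ℝ}
    {v : Fin N → ι → ℝ} (h : IsStaircase w v) {a b : ι → ℝ} (hab : a ⬝ᵥ b = 1)
    (hb : ∀ j, w j ⬝ᵥ b = -1) (ha : ∀ i, a ⬝ᵥ v i = 1) :
    IsStaircase (Fin.cons a w : Fin (N + 2) → ι → ℝ) (Fin.cons b v : Fin (N + 1) → ι → ℝ) := by
  intro j i
  induction j using Fin.cases with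
  | zero => induction i using Fin.cases <;> simp [hab, ha]
  | succ j => induction i using Fin.cases <;> simp [hb, h j]

theorem IsZigzag.exists_staircase {ι : Type*} [Fintype ι] {A B : Set (ι → ℝ)} {N : ℕ}
    {p q : ι → ℝ} {σ τ : ℝ} (h : IsZigzag A B N p σ q τ) :
    ∃ (w : Fin (N + 1) → ι → ℝ) (v : Fin N → ι → ℝ) (s : Fin (N + 1) → ℝ) (t : Fin N → ℝ),
      IsStaircase w v ∧ (∀ j, w j ∈ A) ∧ (∀ i, v i ∈ B) ∧ (∀ j, 0 ≤ s j) ∧ (∀ i, 0 ≤ t i) ∧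
      ∑ j, s j = σ ∧ ∑ i, t i = τ ∧ ∑ j, s j • w j = p ∧ ∑ i, t i • v i = q := by
  induction h with
  | @last A B a s ha hs =>
    exact ⟨fun _ => a, Fin.elim0, fun _ => s, Fin.elim0, fun _ i => i.elim0, fun _ => ha,
      fun i => i.elim0, fun _ => hs, fun i => i.elim0, by simp⟩
  | @step A B a b s t N p q σ τ ha hb hab hs ht _ ih =>
    obtain ⟨w, v, s', t', hwv, hw, hv, hs', ht', rfl, rfl, rfl, rfl⟩ := ih
    refine ⟨Fin.cons a w, Fin.cons b v, Fin.cons s s', Fin.cons t t',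
      hwv.cons hab (fun j => (hw j).2) (fun i => (hv i).2), ?_, ?_, ?_, ?_, ?_⟩
    · exact Fin.cases ha fun j => (hw j).1
    · exact Fin.cases hb fun i => (hv i).1
    · exact Fin.cases hs hs'
    · exact Fin.cases ht ht'
    · simp [Fin.sum_univ_succ]

namespace IsStaircase

variable {n : ℕ} {w : Fin (n + 1) → Fin n → ℝ} {v : Fin n → Fin n → ℝ} (h : IsStaircase w v)

include h

theorem half_sub_dotProduct (i k : Fin n) :
    ((1 / 2 : ℝ) • (w i.castSucc - w i.succ)) ⬝ᵥ v k = if i = k then 1 else 0 := by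
  rw [smul_dotProduct, sub_dotProduct, h, h]
  rcases lt_trichotomy i k with hik | rfl | hik
  · simp [hik.le, hik.ne, Fin.succ_le_castSucc_iff, hik]
  · norm_num
  · simp [hik.not_ge, hik.ne', Fin.succ_le_castSucc_iff, hik.not_gt]

theorem sum_dotProduct_smul (x : Fin n → ℝ) :
    ∑ i, (((1 / 2 : ℝ) • (w i.castSucc - w i.succ)) ⬝ᵥ x) • v i = x :=
  sum_dotProduct_smul_of_biorthogonal h.half_sub_dotProduct x

theorem last_eq_neg_zero : w (Fin.last n) = -w 0 := by
  rw [← add_eq_zero_iff_eq_neg, ← dotProduct_self_eq_zero]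
  set x := w (Fin.last n) + w 0
  have hx : ∀ i, x ⬝ᵥ v i = 0 := fun i => by simp [x, h _ i, add_dotProduct]
  nth_rewrite 2 [← h.sum_dotProduct_smul x]
  simp [dotProduct_sum, hx]

/-- Near such a point all coordinates with respect to the basis `v` are positive, and on this cone
the gauge is linear. -/
theorem gauge_eventuallyEq {K K' : Set (Fin n → ℝ)} (hK : IsPolarPair K K') (hw : w 0 ∈ K')
    (hv : ∀ i, v i ∈ K) {t : Fin n → ℝ} (ht : ∀ i, 0 < t i) :
    gauge K =ᶠ[𝓝 (∑ i, t i • v i)] fun x => w 0 ⬝ᵥ x := by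
  set c : Fin n → (Fin n → ℝ) → ℝ :=
    fun i x => ((1 / 2 : ℝ) • (w i.castSucc - w i.succ)) ⬝ᵥ x with hc
  have hexp : ∀ x, ∑ i, c i x • v i = x := h.sum_dotProduct_smul
  have hcoord : ∀ i, c i (∑ k, t k • v k) = t i := fun i => by
    simp only [hc, dotProduct_sum, dotProduct_smul, h.half_sub_dotProduct]
    simp
  have hpos : ∀ᶠ x in 𝓝 (∑ k, t k • v k), ∀ i, 0 < c i x := by
    refine Filter.eventually_all.2 fun i => ?_
    have hcont : Continuous (c i) := continuous_const.dotProduct continuous_id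
    exact (hcont.tendsto _).eventually_const_lt ((ht i).trans_eq (hcoord i).symm)
  filter_upwards [hpos] with x hx
  refine le_antisymm ?_ (hK.dotProduct_le hw x)
  obtain ⟨p, hp, hpx⟩ := hK.exists_dotProduct_eq_gauge x
  calc gauge K x = ∑ i, c i x * (p ⬝ᵥ v i) := by
        conv_lhs => rw [← hpx, ← hexp x]
        simp only [dotProduct_sum, dotProduct_smul, smul_eq_mul]
    _ ≤ ∑ i, c i x * (w 0 ⬝ᵥ v i) := by
        refine Finset.sum_le_sum fun i _ => mul_le_mul_of_nonneg_left ?_ (hx i).le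
        rw [h 0 i, if_pos (Fin.zero_le _)]
        exact (hK.dotProduct_le hp _).trans (gauge_le_one_of_mem (hv i))
    _ = w 0 ⬝ᵥ x := by
        conv_rhs => rw [← hexp x]
        simp only [dotProduct_sum, dotProduct_smul, smul_eq_mul]

end IsStaircase

section WindowSum

variable {E : Type*} [AddCommGroup E] {n : ℕ} {x : ℕ → E}

/-- The sum of the `n` consecutive terms `x j, …, x (j + n - 1)`. -/
def windowSum (n : ℕ) (x : ℕ → E) (j : ℕ) : E :=
  ∑ i : Fin n, x (j + i)

theorem windowSum_succ_add (n : ℕ) (x : ℕ → E) (j : ℕ) :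
    windowSum n x (j + 1) + x j = windowSum n x j + x (j + n) := by
  have hfirst := Fin.sum_univ_succ fun i : Fin (n + 1) => x (j + i)
  have hlast := Fin.sum_univ_castSucc fun i : Fin (n + 1) => x (j + i)
  rw [hfirst, add_comm] at hlast
  simpa [windowSum, add_assoc, add_comm 1] using hlast

theorem windowSum_of_periodic (hx : Function.Periodic x n) (j : ℕ) :
    windowSum n x j = ∑ i : Fin n, x i := by
  induction j with
  | zero => simp only [windowSum, zero_add]
  | succ j ih =>
    have h := windowSum_succ_add n x j
    rwa [hx, ih, add_left_inj] at h

theorem windowSum_succ_of_antiperiodic (hx : Function.Antiperiodic x n) (j : ℕ) :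
    windowSum n x (j + 1) = windowSum n x j - 2 • x j := by
  rw [eq_sub_of_add_eq (windowSum_succ_add n x j), hx]
  abel

theorem antiperiodic_windowSum (hx : Function.Antiperiodic x n) :
    Function.Antiperiodic (windowSum n x) n := by
  intro j
  rw [windowSum, windowSum, ← Finset.sum_neg_distrib]
  exact Finset.sum_congr rfl fun i _ => by rw [add_right_comm, hx]

end WindowSum

theorem antiperiodic_smul {E : Type*} [AddCommGroup E] [Module ℝ E] {n : ℕ} {t : ℕ → ℝ}
    {V : ℕ → E} (ht : Function.Periodic t n) (hV : Function.Antiperiodic V n) :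
    Function.Antiperiodic (t • V) n := fun i => by
  rw [Pi.smul_apply', Pi.smul_apply', ht, hV, smul_neg]

theorem apply_finRotate {α : Type*} {m : ℕ} {f : ℕ → α} (hf : Function.Periodic f m) (i : Fin m) :
    f (finRotate m i) = f (i + 1) := by
  obtain ⟨m, rfl⟩ := Nat.exists_eq_add_one_of_ne_zero i.pos.ne'
  rw [finRotate_apply, Fin.val_add_one]
  split_ifs with h
  · rw [h, Fin.val_last, ← hf 0, zero_add]
  · rfl

/-- The functional `x ↦ p ⬝ᵥ x`, in the form in which it occurs as a derivative. -/
noncomputable def dotProductCLM {n : ℕ} (p : Fin n → ℝ) : (Fin n → ℝ) →L[ℝ] ℝ :=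
  LinearMap.toContinuousLinearMap (dotProductBilin ℝ ℝ p)

theorem IsPolarPair.outerNormal_eq_of_hasFDerivAt {n : ℕ} {K K' : Set (Fin n → ℝ)}
    (hK : IsPolarPair K K') {p q : Fin n → ℝ} (h : HasFDerivAt (gauge K) (dotProductCLM p) q) :
    outerNormal K q = p := by
  funext i
  rw [outerNormal, hK.polar_left, hK.finslerNorm_eq_gauge, h.fderiv]
  exact dotProduct_single_one p i

/-- Antiperiodic sequences of normals `W` and vertices `V` such that `W j` is the normal of a facet
with vertices `V j, …, V (j + n - 1)`. -/
structure IsFlag {n : ℕ} (K K' : Set (Fin n → ℝ)) (W V : ℕ → Fin n → ℝ) : Prop where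
  antiperiodic_left : Function.Antiperiodic W n
  antiperiodic_right : Function.Antiperiodic V n
  left_mem : ∀ j, W j ∈ K'
  right_mem : ∀ i, V i ∈ K
  pairing : ∀ j, ∀ i < n, W j ⬝ᵥ V (j + i) = 1

/-- Positive `n`-periodic weights of total weight `1` in each period. -/
structure IsWeight (n : ℕ) (t : ℕ → ℝ) : Prop where
  pos : ∀ i, 0 < t i
  periodic : Function.Periodic t n
  sum_eq_one : ∑ i : Fin n, t i = 1

theorem IsWeight.pos_length {n : ℕ} {t : ℕ → ℝ} (ht : IsWeight n t) : 0 < n := by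
  refine Nat.pos_of_ne_zero ?_
  rintro rfl
  simpa using ht.sum_eq_one

theorem IsWeight.shift {n : ℕ} {t : ℕ → ℝ} (ht : IsWeight n t) (k : ℕ) :
    IsWeight n fun i => t (i + k) where
  pos i := ht.pos _
  periodic i := (congrArg t (add_right_comm i n k)).trans (ht.periodic _)
  sum_eq_one := by
    rw [← ht.sum_eq_one, ← windowSum_of_periodic ht.periodic k]
    exact Finset.sum_congr rfl fun i _ => by rw [add_comm]

namespace IsFlag

variable {n : ℕ} {K K' : Set (Fin n → ℝ)} {W V : ℕ → Fin n → ℝ} {s t : ℕ → ℝ}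

theorem dual (h : IsFlag K K' W V) : IsFlag K' K (fun j => V (j + (n - 1))) W where
  antiperiodic_left i := (congrArg V (add_right_comm i n _)).trans (h.antiperiodic_right _)
  antiperiodic_right := h.antiperiodic_left
  left_mem _ := h.right_mem _
  right_mem := h.left_mem
  pairing j i hi := by
    rw [dotProduct_comm, show j + (n - 1) = j + i + (n - 1 - i) by omega]
    exact h.pairing _ _ (by omega)

theorem isStaircase (h : IsFlag K K' W V) (j : ℕ) :
    IsStaircase (fun a : Fin (n + 1) => W (j + a)) fun i : Fin n => V (j + i) := by
  intro a i
  dsimp only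
  split_ifs with hai
  · rw [Fin.le_def, Fin.val_castSucc] at hai
    rw [show j + (i : ℕ) = j + a + (i - a) by omega]
    exact h.pairing _ _ (by omega)
  · rw [Fin.le_def, Fin.val_castSucc] at hai
    rw [← neg_neg (V _), ← h.antiperiodic_right, dotProduct_neg,
      show j + (i : ℕ) + n = j + a + (n + i - a) by omega, h.pairing _ _ (by omega)]

theorem gauge_eventuallyEq (h : IsFlag K K' W V) (hK : IsPolarPair K K') (ht : ∀ i, 0 < t i)
    (j : ℕ) : gauge K =ᶠ[𝓝 (windowSum n (t • V) j)] fun x => W j ⬝ᵥ x :=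
  (h.isStaircase j).gauge_eventuallyEq hK (h.left_mem _) (fun _ => h.right_mem _) fun _ => ht _

theorem hasFDerivAt_gauge (h : IsFlag K K' W V) (hK : IsPolarPair K K') (ht : ∀ i, 0 < t i)
    (j : ℕ) : HasFDerivAt (gauge K) (dotProductCLM (W j)) (windowSum n (t • V) j) :=
  (dotProductCLM (W j)).hasFDerivAt.congr_of_eventuallyEq (h.gauge_eventuallyEq hK ht j)

theorem gauge_windowSum (h : IsFlag K K' W V) (hK : IsPolarPair K K') (ht : IsWeight n t) (j : ℕ) :
    gauge K (windowSum n (t • V) j) = 1 := by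
  rw [(h.gauge_eventuallyEq hK ht.pos j).eq_of_nhds, ← ht.sum_eq_one,
    ← windowSum_of_periodic ht.periodic j]
  simp only [windowSum, dotProduct_sum, Pi.smul_apply', dotProduct_smul, smul_eq_mul,
    h.pairing _ _ (Fin.is_lt _), mul_one]

theorem windowSum_mem_smoothBoundary (h : IsFlag K K' W V) (hK : IsPolarPair K K')
    (ht : IsWeight n t) (j : ℕ) : windowSum n (t • V) j ∈ smoothBoundary K := by
  refine ⟨hK.mem_frontier_iff.2 (h.gauge_windowSum hK ht j), ?_⟩
  rw [hK.polar_left, hK.finslerNorm_eq_gauge]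
  exact (h.hasFDerivAt_gauge hK ht.pos j).differentiableAt

theorem outerNormal_windowSum (h : IsFlag K K' W V) (hK : IsPolarPair K K') (ht : ∀ i, 0 < t i)
    (j : ℕ) : outerNormal K (windowSum n (t • V) j) = W j :=
  hK.outerNormal_eq_of_hasFDerivAt (h.hasFDerivAt_gauge hK ht j)

theorem windowSum_succ (h : IsFlag K K' W V) (ht : Function.Periodic t n) (j : ℕ) :
    windowSum n (t • V) (j + 1) = windowSum n (t • V) j - (2 * t j) • V j := by
  rw [windowSum_succ_of_antiperiodic (antiperiodic_smul ht h.antiperiodic_right), Pi.smul_apply',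
    mul_smul, two_smul, two_smul]

theorem periodic_windowSum (h : IsFlag K K' W V) (ht : Function.Periodic t n) :
    Function.Periodic (windowSum n (t • V)) (2 * n) := by
  have := (antiperiodic_windowSum (antiperiodic_smul ht h.antiperiodic_right)).periodic_two_mul
  simpa using this

theorem gauge_right (h : IsFlag K K' W V) (hK : IsPolarPair K K') (hn : 0 < n) (i : ℕ) :
    gauge K (V i) = 1 := by
  refine le_antisymm (gauge_le_one_of_mem (h.right_mem i)) ?_
  rw [← h.pairing i 0 hn]
  exact hK.dotProduct_le (h.left_mem i) _

theorem isClassicalTrajectory (h : IsFlag K K' W V) (hK : IsPolarPair K K') (hs : IsWeight n s)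
    (ht : IsWeight n t) :
    IsClassicalTrajectory (m := 2 * n) K K' (fun i => windowSum n (t • V) i)
      (fun i => windowSum n (s • W) i) := by
  have hn := hs.pos_length
  have hperV := h.periodic_windowSum ht.periodic
  have hperW := h.dual.periodic_windowSum hs.periodic
  refine ⟨by omega, fun i => h.windowSum_mem_smoothBoundary hK ht i,
    fun i => h.dual.windowSum_mem_smoothBoundary hK.symm hs i,
    fun i => ⟨2 * t i, mul_pos two_pos (ht.pos _), ?_⟩,
    fun i => ⟨2 * s i, mul_pos two_pos (hs.pos _), ?_⟩⟩
  · rw [apply_finRotate hperV, apply_finRotate hperW, h.dual.outerNormal_windowSum hK.symm hs.pos,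
      h.windowSum_succ ht.periodic, show (i : ℕ) + 1 + (n - 1) = i + n by omega,
      h.antiperiodic_right, smul_neg, sub_sub_cancel_left]
  · rw [apply_finRotate hperW, h.outerNormal_windowSum hK ht.pos, h.dual.windowSum_succ hs.periodic,
      sub_sub_cancel_left]

theorem closedLength_eq_four (h : IsFlag K K' W V) (hK : IsPolarPair K K') (ht : IsWeight n t) :
    closedLength (m := 2 * n) K' (fun i => windowSum n (t • V) i) = 4 := by
  have hstep : ∀ i : Fin (2 * n), finslerNorm K' (windowSum n (t • V) (finRotate (2 * n) i : ℕ) -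
      windowSum n (t • V) i) = 2 * t i := fun i => by
    rw [hK.finslerNorm_eq_gauge, apply_finRotate (h.periodic_windowSum ht.periodic),
      h.windowSum_succ ht.periodic, sub_sub_cancel_left, hK.gauge_neg,
      gauge_smul_of_nonneg (mul_pos two_pos (ht.pos _)).le, h.gauge_right hK ht.pos_length,
      smul_eq_mul, mul_one]
  calc closedLength (m := 2 * n) K' (fun i => windowSum n (t • V) i)
      = 2 * ∑ i ∈ Finset.range (2 * n), t i := by
        rw [closedLength, Finset.sum_congr rfl fun i _ => hstep i, ← Finset.mul_sum,
          Fin.sum_univ_eq_sum_range]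
    _ = 2 * (windowSum n t 0 + windowSum n t n) := by
        rw [two_mul n, Finset.sum_range_add]
        simp only [Finset.sum_range, windowSum, zero_add]
    _ = 4 := by
        rw [windowSum_of_periodic ht.periodic, windowSum_of_periodic ht.periodic, ht.sum_eq_one]
        norm_num

end IsFlag

/-! ### Flags through a given phase point -/

section Antiperiodize

variable {E : Type*} [AddCommGroup E] [Module ℝ E] {n : ℕ} [NeZero n]

/-- The `n`-antiperiodic sequence with the given first `n` terms. -/
def antiperiodize (v : Fin n → E) (i : ℕ) : E :=
  (-1 : ℝ) ^ (i / n) • v (Fin.ofNat n i)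

theorem antiperiodic_antiperiodize (v : Fin n → E) : Function.Antiperiodic (antiperiodize v) n := by
  intro i
  have hi : Fin.ofNat n (i + n) = Fin.ofNat n i := Fin.ext (Nat.add_mod_right i n)
  rw [antiperiodize, antiperiodize, hi, Nat.add_div_right i (NeZero.pos n), pow_succ, mul_neg_one,
    neg_smul]

theorem antiperiodize_val (v : Fin n → E) (i : Fin n) : antiperiodize v i = v i := by
  rw [antiperiodize, Nat.div_eq_of_lt i.2, pow_zero, one_smul, Fin.ofNat_val_eq_self]

theorem antiperiodize_mem {S : Set E} (hS : ∀ x ∈ S, -x ∈ S) {v : Fin n → E} (hv : ∀ i, v i ∈ S)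
    (i : ℕ) : antiperiodize v i ∈ S := by
  rcases neg_one_pow_eq_or ℝ (i / n) with h | h
  · simpa only [antiperiodize, h, one_smul] using hv _
  · simpa only [antiperiodize, h, neg_smul, one_smul] using hS _ (hv _)

theorem windowSum_antiperiodize (t : Fin n → ℝ) (v : Fin n → E) :
    windowSum n ((fun i => t (Fin.ofNat n i)) • antiperiodize v) 0 = ∑ i, t i • v i := by
  refine Finset.sum_congr rfl fun i _ => ?_
  rw [zero_add, Pi.smul_apply', antiperiodize_val, Fin.ofNat_val_eq_self]

theorem isWeight_comp_ofNat {t : Fin n → ℝ} (ht : ∀ i, 0 < t i) (hsum : ∑ i, t i = 1) :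
    IsWeight n fun i => t (Fin.ofNat n i) where
  pos _ := ht _
  periodic i := congrArg t (Fin.ext (Nat.add_mod_right i n))
  sum_eq_one := by simpa only [Fin.ofNat_val_eq_self] using hsum

end Antiperiodize

/-- Weights of `w₀, …, w_{n-1}` obtained from weights of `w₀, …, w_n` by moving the last weight to
`w₀ = -w_n`. -/
def foldLast {n : ℕ} [NeZero n] (s : Fin (n + 1) → ℝ) : Fin n → ℝ :=
  s ∘ Fin.castSucc + Pi.single 0 (s (Fin.last n))

namespace IsStaircase

variable {n : ℕ} {w : Fin (n + 1) → Fin n → ℝ} {v : Fin n → Fin n → ℝ} (h : IsStaircase w v)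

include h

theorem antiperiodize_dotProduct [NeZero n] (j : ℕ) {i : ℕ} (hi : i < n) :
    antiperiodize (w ∘ Fin.castSucc) j ⬝ᵥ antiperiodize v (j + i) = 1 := by
  induction j using Nat.strong_induction_on with
  | _ j ih =>
    have hW := antiperiodic_antiperiodize (w ∘ Fin.castSucc)
    have hV := antiperiodic_antiperiodize v
    rcases lt_or_ge j n with hj | hj
    · rw [antiperiodize_val _ ⟨j, hj⟩, Function.comp_apply]
      rcases lt_or_ge (j + i) n with hji | hji
      · rw [antiperiodize_val _ ⟨j + i, hji⟩, h, if_pos]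
        exact Nat.le_add_right j i
      · obtain ⟨c, hc⟩ := Nat.exists_eq_add_of_le' hji
        rw [hc, hV, dotProduct_neg, antiperiodize_val _ ⟨c, by omega⟩, h, if_neg, neg_neg]
        exact not_le_of_gt (show c < j by omega)
    · obtain ⟨k, rfl⟩ := Nat.exists_eq_add_of_le' hj
      rw [add_right_comm, hW, hV, neg_dotProduct_neg]
      exact ih k (Nat.lt_add_of_pos_right (NeZero.pos n))

theorem isFlag_antiperiodize [NeZero n] {K K' : Set (Fin n → ℝ)} (hK : IsPolarPair K K')
    (hw : ∀ j, w j ∈ K') (hv : ∀ i, v i ∈ K) :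
    IsFlag K K' (antiperiodize (w ∘ Fin.castSucc)) (antiperiodize v) where
  antiperiodic_left := antiperiodic_antiperiodize _
  antiperiodic_right := antiperiodic_antiperiodize _
  left_mem := antiperiodize_mem hK.symm.neg_mem fun _ => hw _
  right_mem := antiperiodize_mem hK.neg_mem hv
  pairing j _ := h.antiperiodize_dotProduct j

/-- Because of the sign in `w_n = -w₀`, twice the moved weight has to be subtracted. -/
theorem sum_smul_eq_windowSum_sub [NeZero n] (s : Fin (n + 1) → ℝ) :
    ∑ j, s j • w j =
      windowSum n ((fun i => foldLast s (Fin.ofNat n i)) • antiperiodize (w ∘ Fin.castSucc)) 0 -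
        (2 * s (Fin.last n)) • antiperiodize (w ∘ Fin.castSucc) 0 := by
  have hfirst : antiperiodize (w ∘ Fin.castSucc) 0 = w 0 := antiperiodize_val _ (0 : Fin n)
  rw [windowSum_antiperiodize, hfirst, Fin.sum_univ_castSucc, h.last_eq_neg_zero]
  simp only [foldLast, Pi.add_apply, add_smul, Finset.sum_add_distrib, Pi.single_apply, ite_smul,
    zero_smul, Finset.sum_ite_eq', Finset.mem_univ, if_true, Function.comp_apply,
    Fin.castSucc_zero', two_mul]
  rw [smul_neg]
  abel

end IsStaircase

theorem stdSimplex_subset_closure_pos {ι : Type*} [Fintype ι] :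
    stdSimplex ℝ ι ⊆ closure {s ∈ stdSimplex ℝ ι | ∀ i, 0 < s i} := by
  intro s hs
  have hι : Nonempty ι := by
    by_contra hι
    rw [not_nonempty_iff] at hι
    simpa using hs.2
  have hcard : (0 : ℝ) < (Fintype.card ι : ℝ)⁻¹ := inv_pos.2 (Nat.cast_pos.2 Fintype.card_pos)
  have hbary : (fun _ => (Fintype.card ι : ℝ)⁻¹) ∈ stdSimplex ℝ ι :=
    ⟨fun _ => hcard.le, by simp⟩
  have hseg : openSegment ℝ s (fun _ => (Fintype.card ι : ℝ)⁻¹) ⊆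
      {s ∈ stdSimplex ℝ ι | ∀ i, 0 < s i} := fun r hr => by
    refine ⟨(convex_stdSimplex ℝ ι).openSegment_subset hs hbary hr, fun i => ?_⟩
    obtain ⟨a, b, ha, hb, -, rfl⟩ := hr
    exact add_pos_of_nonneg_of_pos (mul_nonneg ha.le (hs.1 i)) (mul_pos hb hcard)
  refine closure_mono hseg ?_
  rw [closure_openSegment]
  exact left_mem_segment ℝ _ _

/-- The point with coordinate `∑ tᵢ vᵢ` and momentum `∑ sⱼ wⱼ` depends continuously on the weights,
so these can be made positive. -/
theorem IsPolarPair.exists_flag {n : ℕ} {K K' : Set (Fin n → ℝ)} (hK : IsPolarPair K K')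
    (hKK' : ZigzagSpanned K K') {q p : Fin n → ℝ} (hq : q ∈ frontier K) (hp : p ∈ K')
    {U : Set ((Fin n → ℝ) × (Fin n → ℝ))} (hU : U ∈ 𝓝 (q, p)) :
    ∃ W V s t σ, IsFlag K K' W V ∧ IsWeight n s ∧ IsWeight n t ∧ 0 ≤ σ ∧ σ ≤ s 0 ∧
      (windowSum n (t • V) 0, windowSum n (s • W) 0 - (2 * σ) • W 0) ∈ U := by
  obtain ⟨w, v, s₀, t₀, hwv, hw, hv, hs₀, ht₀, hs₀_sum, ht₀_sum, rfl, rfl⟩ :=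
    (hKK' q p 1 (gauge_le_one_of_mem hp)).exists_staircase
  rw [hK.mem_frontier_iff.1 hq] at ht₀_sum
  have : NeZero n := ⟨by
    rintro rfl
    simp at ht₀_sum⟩
  set f : (Fin (n + 1) → ℝ) × (Fin n → ℝ) → (Fin n → ℝ) × (Fin n → ℝ) :=
    fun x => (∑ i, x.2 i • v i, ∑ j, x.1 j • w j)
  have hf : Continuous f := by fun_prop
  have hclosure : (s₀, t₀) ∈ closure ({s ∈ stdSimplex ℝ (Fin (n + 1)) | ∀ j, 0 < s j} ×ˢ
      {t ∈ stdSimplex ℝ (Fin n) | ∀ i, 0 < t i}) := by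
    rw [closure_prod_eq]
    exact ⟨stdSimplex_subset_closure_pos ⟨hs₀, hs₀_sum⟩,
      stdSimplex_subset_closure_pos ⟨ht₀, ht₀_sum⟩⟩
  obtain ⟨⟨s, t⟩, hst, ⟨⟨-, hs_sum⟩, hs⟩, ⟨-, ht_sum⟩, ht⟩ :=
    mem_closure_iff_nhds.1 hclosure _ (hf.continuousAt.preimage_mem_nhds hU)
  have hfold : 0 ≤ (Pi.single 0 (s (Fin.last n)) : Fin n → ℝ) := Pi.single_nonneg.2 (hs _).le
  refine ⟨_, _, _, _, s (Fin.last n), hwv.isFlag_antiperiodize hK hw hv,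
    isWeight_comp_ofNat (t := foldLast s)
      (fun i => add_pos_of_pos_of_nonneg (hs _) (hfold i)) ?_,
    isWeight_comp_ofNat ht ht_sum, (hs _).le, ?_, ?_⟩
  · rw [← hs_sum, Fin.sum_univ_castSucc]
    simp [foldLast, Finset.sum_add_distrib]
  · simpa [foldLast] using (hs 0).le
  · rw [windowSum_antiperiodize, ← hwv.sum_smul_eq_windowSum_sub]
    exact hst

theorem sub_smul_mem_segment {E : Type*} [AddCommGroup E] [Module ℝ E] (x v : E) {c d : ℝ}
    (hc : 0 ≤ c) (hcd : c ≤ d) : x - c • v ∈ segment ℝ x (x - d • v) := by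
  rcases hc.eq_or_lt with rfl | hc
  · rw [zero_smul, sub_zero]
    exact left_mem_segment ℝ _ _
  · have hd := hc.trans_le hcd
    rw [segment_eq_image']
    refine ⟨c / d, ⟨div_nonneg hc.le hd.le, (div_le_one hd).2 hcd⟩, ?_⟩
    dsimp only
    rw [sub_sub_cancel_left, smul_neg, smul_smul, div_mul_cancel₀ _ hd.ne', sub_eq_add_neg]

namespace IsFlag

variable {n : ℕ} {K K' : Set (Fin n → ℝ)} {W V : ℕ → Fin n → ℝ} {s t : ℕ → ℝ} {σ : ℝ}

theorem mem_phaseCurve_bounce (h : IsFlag K K' W V) (hs : IsWeight n s) (hσ : 0 ≤ σ)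
    (hσs : σ ≤ s 0) :
    (windowSum n (t • V) 0, windowSum n (s • W) 0 - (2 * σ) • W 0) ∈
      phaseCurve (m := 2 * n) (fun i => windowSum n (t • V) i)
        (fun i => windowSum n (s • W) i) := by
  have hn := hs.pos_length
  refine Set.mem_iUnion.2 ⟨⟨0, by omega⟩, Or.inr ?_⟩
  dsimp only
  rw [apply_finRotate (h.dual.periodic_windowSum hs.periodic), h.dual.windowSum_succ hs.periodic,
    ← Prod.image_mk_segment_right]
  exact ⟨_, sub_smul_mem_segment _ _ (by linarith) (by linarith), rfl⟩

theorem mem_phaseCurve_flight (h : IsFlag K K' W V) (hs : IsWeight n s) (ht : IsWeight n t)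
    (hσ : 0 ≤ σ) (hσt : σ ≤ t 0) :
    (windowSum n (t • V) 0 - (2 * σ) • V 0, windowSum n (s • W) 1) ∈
      phaseCurve (m := 2 * n) (fun i => windowSum n (t • V) i)
        (fun i => windowSum n (s • W) i) := by
  have hn := hs.pos_length
  refine Set.mem_iUnion.2 ⟨⟨0, by omega⟩, Or.inl ?_⟩
  dsimp only
  rw [apply_finRotate (h.dual.periodic_windowSum hs.periodic),
    apply_finRotate (h.periodic_windowSum ht.periodic), h.windowSum_succ ht.periodic,
    ← Prod.image_mk_segment_left]
  exact ⟨_, sub_smul_mem_segment _ _ (by linarith) (by linarith), rfl⟩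

theorem windowSum_dual (h : IsFlag K K' W V) (ht : IsWeight n t) :
    windowSum n ((fun i => t (i + (n - 1))) • fun i => V (i + (n - 1))) 1 =
      -windowSum n (t • V) 0 := by
  have hn := ht.pos_length
  rw [← antiperiodic_windowSum (antiperiodic_smul ht.periodic h.antiperiodic_right) 0]
  refine Finset.sum_congr rfl fun i _ => ?_
  rw [Pi.smul_apply', Pi.smul_apply', show 1 + (i : ℕ) + (n - 1) = 0 + n + i by omega]

end IsFlag

/-- At a boundary point of `K` the phase point is on a bounce segment. At a boundary point of `K'`
the roles of the bodies are exchanged: the phase point is on a flight segment of the dual flag. -/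
theorem IsPolarPair.exists_flag_phaseCurve_inter_nonempty {n : ℕ} {K K' : Set (Fin n → ℝ)}
    (hK : IsPolarPair K K') (hKK' : ZigzagSpanned K K') (hK'K : ZigzagSpanned K' K)
    {q p : Fin n → ℝ} (hqp : (q, p) ∈ frontier (K ×ˢ K')) {U : Set ((Fin n → ℝ) × (Fin n → ℝ))}
    (hU : U ∈ 𝓝 (q, p)) :
    ∃ W V s t, IsFlag K K' W V ∧ IsWeight n s ∧ IsWeight n t ∧
      (phaseCurve (m := 2 * n) (fun i => windowSum n (t • V) i) (fun i => windowSum n (s • W) i) ∩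
        U).Nonempty := by
  rw [frontier_prod_eq, hK.isClosed.closure_eq, hK.symm.isClosed.closure_eq] at hqp
  rcases hqp with ⟨hq, hp⟩ | ⟨hq, hp⟩
  · have hswap : Continuous fun z : (Fin n → ℝ) × (Fin n → ℝ) => (z.2, -z.1) := by fun_prop
    have hp_neg : -p ∈ frontier K' := by
      rw [hK.symm.mem_frontier_iff, hK.symm.gauge_neg, ← hK.symm.mem_frontier_iff]
      exact hp
    obtain ⟨W, V, s, t, σ, hWV, hs, ht, hσ, hσs, hmem⟩ := hK.symm.exists_flag hK'K hp_neg hq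
      (hswap.continuousAt.preimage_mem_nhds (x := (-p, q)) (by simpa using hU))
    refine ⟨_, _, _, _, hWV.dual, ht.shift (n - 1), hs, _,
      hWV.dual.mem_phaseCurve_flight (ht.shift (n - 1)) hs hσ hσs, ?_⟩
    rw [hWV.windowSum_dual ht]
    exact hmem
  · obtain ⟨W, V, s, t, σ, hWV, hs, ht, hσ, hσs, hmem⟩ := hK.exists_flag hKK' hq hp hU
    exact ⟨W, V, s, t, hWV, hs, ht, _, hWV.mem_phaseCurve_bounce hs hσ hσs, hmem⟩

/-! ### The lower bound for the length -/

section ArcLength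

variable {E : Type*} [AddCommGroup E] [Module ℝ E] (N : Seminorm ℝ E) (x : ℕ → E)

/-- The length of the polygonal line `x 0, …, x m` with respect to the seminorm `N`. -/
def arcLength (m : ℕ) : ℝ :=
  ∑ i ∈ Finset.range m, N (x (i + 1) - x i)

theorem arcLength_zero : arcLength N x 0 = 0 := Finset.sum_range_zero _

theorem arcLength_succ (m : ℕ) : arcLength N x (m + 1) = arcLength N x m + N (x (m + 1) - x m) :=
  Finset.sum_range_succ _ m

theorem arcLength_nonneg (m : ℕ) : 0 ≤ arcLength N x m :=
  Finset.sum_nonneg fun _ _ => apply_nonneg N _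

theorem seminorm_sub_le_arcLength_sub {i j : ℕ} (hij : i ≤ j) :
    N (x j - x i) ≤ arcLength N x j - arcLength N x i := by
  induction j, hij using Nat.le_induction with
  | base => simp
  | succ j _ ih =>
    rw [arcLength_succ]
    linarith [le_map_sub_add_map_sub N (x (j + 1)) (x j) (x i)]

theorem exists_seminorm_sub_le_of_mem_Icc (y z : E) {s : ℝ} (hs : s ∈ Set.Icc 0 (N (z - y))) :
    ∃ b, N (y - b) ≤ s ∧ N (z - b) ≤ N (z - y) - s := by
  obtain ⟨θ, ⟨hθ₀, hθ₁⟩, rfl⟩ : s ∈ (fun θ : ℝ => θ * N (z - y)) '' Set.Icc 0 1 := by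
    rcases (apply_nonneg N (z - y)).eq_or_lt with hd | hd
    · exact ⟨0, ⟨le_rfl, zero_le_one⟩, by linarith [hs.1, hs.2]⟩
    · exact ⟨s / N (z - y), ⟨div_nonneg hs.1 hd.le, (div_le_one hd).2 hs.2⟩,
        div_mul_cancel₀ s hd.ne'⟩
  refine ⟨y + θ • (z - y), le_of_eq ?_, le_of_eq ?_⟩
  · rw [sub_add_cancel_left, map_neg_eq_map, map_smul_eq_mul, Real.norm_of_nonneg hθ₀]
  · have hz : z - (y + θ • (z - y)) = (1 - θ) • (z - y) := by module
    rw [hz, map_smul_eq_mul, Real.norm_of_nonneg (sub_nonneg.2 hθ₁), sub_mul, one_mul]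

theorem exists_seminorm_sub_le_abs_arcLength_sub (m : ℕ) {r : ℝ}
    (hr : r ∈ Set.Icc 0 (arcLength N x m)) :
    ∃ b, ∀ i ≤ m, N (x i - b) ≤ |arcLength N x i - r| := by
  induction m with
  | zero =>
    refine ⟨x 0, fun i hi => ?_⟩
    rw [Nat.le_zero.1 hi, sub_self, map_zero]
    exact abs_nonneg _
  | succ m ih =>
    have hsucc := arcLength_succ N x m
    rcases le_or_gt r (arcLength N x m) with hrm | hrm
    · obtain ⟨b, hb⟩ := ih ⟨hr.1, hrm⟩
      refine ⟨b, fun i hi => ?_⟩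
      rcases Nat.le_succ_iff.1 hi with hi | rfl
      · exact hb i hi
      · have hbm := hb m le_rfl
        rw [abs_of_nonneg (sub_nonneg.2 hrm)] at hbm
        refine le_trans ?_ (le_abs_self _)
        linarith [le_map_sub_add_map_sub N (x (m + 1)) (x m) b]
    · obtain ⟨b, hmb, hbm⟩ := exists_seminorm_sub_le_of_mem_Icc N (x m) (x (m + 1))
        (s := r - arcLength N x m) ⟨by linarith, by linarith [hr.2]⟩
      refine ⟨b, fun i hi => ?_⟩
      rcases Nat.le_succ_iff.1 hi with hi | rfl
      · have hseg := seminorm_sub_le_arcLength_sub N x hi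
        rw [map_sub_rev] at hseg
        refine le_trans ?_ (neg_le_abs _)
        linarith [le_map_sub_add_map_sub N (x i) (x m) b]
      · refine le_trans ?_ (le_abs_self _)
        linarith

theorem exists_seminorm_sub_le_arcLength_div_four {m : ℕ} (hx : x m = x 0) :
    ∃ c, ∀ i ≤ m, N (x i - c) ≤ arcLength N x m / 4 := by
  set L := arcLength N x m
  have hL : 0 ≤ L := arcLength_nonneg N x m
  obtain ⟨b, hb⟩ := exists_seminorm_sub_le_abs_arcLength_sub N x m
    (r := L / 2) ⟨by linarith, by linarith⟩
  refine ⟨(1 / 2 : ℝ) • (x 0 + b), fun i hi => ?_⟩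
  have hforth := seminorm_sub_le_arcLength_sub N x i.zero_le
  have hback := seminorm_sub_le_arcLength_sub N x hi
  rw [arcLength_zero, sub_zero] at hforth
  rw [hx, map_sub_rev] at hback
  have hsum : N (x i - x 0) + N (x i - b) ≤ L / 2 := by
    rcases abs_cases (arcLength N x i - L / 2) with h | h <;> linarith [hb i hi, h.1]
  have hmid : x i - (1 / 2 : ℝ) • (x 0 + b) = (1 / 2 : ℝ) • ((x i - x 0) + (x i - b)) := by
    module
  calc N (x i - (1 / 2 : ℝ) • (x 0 + b)) = 1 / 2 * N ((x i - x 0) + (x i - b)) := by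
        rw [hmid, map_smul_eq_mul, Real.norm_of_nonneg one_half_pos.le]
    _ ≤ 1 / 2 * (N (x i - x 0) + N (x i - b)) := by
        gcongr
        exact map_add_le_add N _ _
    _ ≤ L / 4 := by linarith

end ArcLength

namespace IsPolarPair

variable {n m : ℕ} {K K' : Set (Fin n → ℝ)} (hK : IsPolarPair K K')

include hK

theorem four_le_closedLength {q : Fin m → Fin n → ℝ} (hq : q ∈ nonTranslatable K m) :
    4 ≤ closedLength K' q := by
  obtain _ | m := m
  · exact (hq ⟨0, fun i => i.elim0⟩).elim
  set x : ℕ → Fin n → ℝ := fun i => q (Fin.ofNat (m + 1) i)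
  have hper : Function.Periodic x (m + 1) :=
    fun i => congrArg q (Fin.ext (Nat.add_mod_right i (m + 1)))
  have hxq : ∀ i : Fin (m + 1), x i = q i := fun i => congrArg q (Fin.ofNat_val_eq_self i)
  set N := gaugeSeminorm ((balanced_iff_neg_mem hK.convex).2 hK.neg_mem) hK.convex hK.absorbent
  have hlength : closedLength K' q = arcLength N x (m + 1) := by
    rw [arcLength, ← Fin.sum_univ_eq_sum_range, closedLength, hK.finslerNorm_eq_gauge]
    refine Finset.sum_congr rfl fun i _ => ?_
    rw [← hxq, ← hxq, apply_finRotate hper]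
    rfl
  by_contra! hlt
  obtain ⟨c, hc⟩ := exists_seminorm_sub_le_arcLength_div_four N x (hper.eq)
  refine hq ⟨c, fun i => hK.mem_interior_iff.2 ?_⟩
  rw [← hxq]
  refine (hc i i.2.le).trans_lt ?_
  rw [← hlength]
  linarith

theorem outerNormal_mem_and_dotProduct_eq_one {q : Fin n → ℝ} (hq : q ∈ smoothBoundary K) :
    outerNormal K q ∈ K' ∧ outerNormal K q ⬝ᵥ q = 1 := by
  obtain ⟨hq_frontier, hdiff⟩ := hq
  rw [hK.polar_left, hK.finslerNorm_eq_gauge] at hdiff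
  obtain ⟨p, hp, hpq⟩ := hK.exists_dotProduct_eq_gauge q
  have hmin : IsLocalMin (fun x => gauge K x - dotProductCLM p x) q := by
    refine Filter.Eventually.of_forall fun x => ?_
    change gauge K q - p ⬝ᵥ q ≤ gauge K x - p ⬝ᵥ x
    linarith [hK.dotProduct_le hp x]
  have hderiv : fderiv ℝ (gauge K) q = dotProductCLM p :=
    sub_eq_zero.1 (hmin.hasFDerivAt_eq_zero (hdiff.hasFDerivAt.sub (dotProductCLM p).hasFDerivAt))
  rw [hK.outerNormal_eq_of_hasFDerivAt (hderiv ▸ hdiff.hasFDerivAt), hpq]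
  exact ⟨hp, hK.mem_frontier_iff.1 hq_frontier⟩

/-- If the bounce points were in `t + int K`, then all normals would pair positively with `t`,
whereas a positive combination of them, the total momentum change, is zero. -/
theorem bouncePoints_mem_nonTranslatable {T : Set (Fin n → ℝ)} {q p : Fin m → Fin n → ℝ}
    (hqp : IsClassicalTrajectory K T q p) : q ∈ nonTranslatable K m := by
  rintro ⟨t, ht⟩
  choose r hr hreflect using hqp.reflection
  have hpos : ∀ i, 0 < outerNormal K (q i) ⬝ᵥ t := fun i => by
    obtain ⟨hmem, hone⟩ := hK.outerNormal_mem_and_dotProduct_eq_one (hqp.coord_mem i)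
    have hlt := (hK.dotProduct_le hmem (q i - t)).trans_lt (hK.mem_interior_iff.1 (ht i))
    rw [dotProduct_sub, hone] at hlt
    linarith
  have hzero : ∑ i, r i * (outerNormal K (q i) ⬝ᵥ t) = 0 := by
    calc ∑ i, r i * (outerNormal K (q i) ⬝ᵥ t) = -((∑ i, (p (finRotate m i) - p i)) ⬝ᵥ t) := by
          simp only [hreflect, Finset.sum_neg_distrib, neg_dotProduct, sum_dotProduct,
            smul_dotProduct, smul_eq_mul, neg_neg]
      _ = 0 := by
          rw [Finset.sum_sub_distrib, Equiv.sum_comp (finRotate m) p, sub_self, zero_dotProduct,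
            neg_zero]
  have : Nonempty (Fin m) := ⟨⟨0, two_pos.trans_le hqp.two_le⟩⟩
  exact (Finset.sum_pos (fun i _ => mul_pos (hr i) (hpos i)) Finset.univ_nonempty).ne' hzero

end IsPolarPair

end Billiard

theorem mainTheorem7 {n : ℕ} (H : Set (Fin n → ℝ)) (hH : Billiard.IsHanner n H)
    (q₀ p₀ : Fin n → ℝ) (h₀ : (q₀, p₀) ∈ frontier (H ×ˢ Billiard.polarBody H))
    (U : Set ((Fin n → ℝ) × (Fin n → ℝ))) (hU : U ∈ 𝓝 (q₀, p₀)) :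
    ∃ (m : ℕ) (q p : Fin m → Fin n → ℝ),
      Billiard.IsClassicalTrajectory H (Billiard.polarBody H) q p ∧
      IsLeast (Billiard.candidateLengths H (Billiard.polarBody H))
        (Billiard.closedLength (Billiard.polarBody H) q) ∧
      (∀ (m' : ℕ) (q' p' : Fin m' → Fin n → ℝ),
        Billiard.IsClassicalTrajectory H (Billiard.polarBody H) q' p' →
          Billiard.closedLength (Billiard.polarBody H) q ≤
            Billiard.closedLength (Billiard.polarBody H) q') ∧
      (Billiard.phaseCurve q p ∩ U).Nonempty := by
  obtain ⟨H', hpolar, hHH', hH'H⟩ := hH.exists_polarPair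
  rw [hpolar.polar_left] at h₀ ⊢
  obtain ⟨W, V, s, t, hflag, hs, ht, hmeet⟩ :=
    hpolar.exists_flag_phaseCurve_inter_nonempty hHH' hH'H h₀ hU
  have htraj := hflag.isClassicalTrajectory hpolar hs ht
  have hlength := hflag.closedLength_eq_four hpolar ht
  have hcandidate := hpolar.bouncePoints_mem_nonTranslatable htraj
  refine ⟨2 * n, _, _, htraj, ⟨⟨_, htraj.two_le, _, hcandidate, rfl⟩, ?_⟩, ?_, hmeet⟩ <;>
    rw [hlength]
  · rintro _ ⟨m, -, q, hq, rfl⟩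
    exact hpolar.four_le_closedLength hq
  · intro m' q' p' htraj'
    exact hpolar.four_le_closedLength (hpolar.bouncePoints_mem_nonTranslatable htraj')
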